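/- Let $\mathbb{F}$ be a field and let $V=\mathbb{F}^2\otimes\mathbb{F}^3\otimes\mathbb{F}^3$. Let $H\le \mathrm{GL}(V)$ be the image of $\mathrm{GL}(\mathbb{F}^2)\times\mathrm{GL}(\mathbb{F}^3)\times\mathrm{GL}(\mathbb{F}^3)$ under the action determined by $(g_1,g_2,g_3): v_1\otimes v_2\otimes v_3\mapsto g_1v_1\otimes g_2v_2\otimes g_3v_3$, and let $G\le\mathrm{GL}(V)$ be the setwise stabiliser of the set $\{v_1\otimes v_2\otimes v_3 : v_1\in\mathbb{F}^2\setminus\{0\},\ v_2,v_3\in\mathbb{F}^3\setminus\{0\}\}$ of rank one tensors. Count orbits on all of $V$, including the orbit $\{0\}$. 1. If $\mathbb{F}$ is a finite field, then there are precisely $21$ $H$-orbits and precisely $18$ $G$-orbits on $V$. 2. If $\mathbb{F}$ is algebraically closed, then there are precisely $18$ $H$-orbits and precisely $15$ $G$-orbits on $V$. 3. If $\mathbb{F}=\mathbb{R}$, then there are precisely $20$ $H$-orbits and precisely $17$ $G$-orbits on $V$. -/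

import Mathlib

open scoped TensorProduct Pointwise

namespace TensorOrbits

section

variable (F V₁ V₂ V₃ : Type*) [Field F]
  [AddCommGroup V₁] [Module F V₁] [AddCommGroup V₂] [Module F V₂] [AddCommGroup V₃] [Module F V₃]

/-- The fundamental (rank one) tensors: `v₁ ⊗ v₂ ⊗ v₃` with all `vᵢ` nonzero. -/
def fundamentalTensors : Set (V₁ ⊗[F] (V₂ ⊗[F] V₃)) :=
  {A | ∃ (v₁ : V₁) (v₂ : V₂) (v₃ : V₃), v₁ ≠ 0 ∧ v₂ ≠ 0 ∧ v₃ ≠ 0 ∧ A = v₁ ⊗ₜ[F] (v₂ ⊗ₜ[F] v₃)}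

/-- The group `G`: the setwise stabiliser in `GL(V₁ ⊗ V₂ ⊗ V₃)` of the set of fundamental tensors. -/
def groupG : Subgroup ((V₁ ⊗[F] (V₂ ⊗[F] V₃)) ≃ₗ[F] (V₁ ⊗[F] (V₂ ⊗[F] V₃))) :=
  MulAction.stabilizer _ (fundamentalTensors F V₁ V₂ V₃)

/-- The action of `GL(V₁) × GL(V₂) × GL(V₃)` on `V₁ ⊗ V₂ ⊗ V₃`, determined by
`(g₁, g₂, g₃) (v₁ ⊗ v₂ ⊗ v₃) = g₁ v₁ ⊗ g₂ v₂ ⊗ g₃ v₃`. -/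
noncomputable def tensorAction : (V₁ ≃ₗ[F] V₁) × (V₂ ≃ₗ[F] V₂) × (V₃ ≃ₗ[F] V₃) →*
    ((V₁ ⊗[F] (V₂ ⊗[F] V₃)) ≃ₗ[F] (V₁ ⊗[F] (V₂ ⊗[F] V₃))) where
  toFun g := TensorProduct.congr g.1 (TensorProduct.congr g.2.1 g.2.2)
  map_one' := by
    apply LinearEquiv.toLinearMap_injective
    ext
    rfl
  map_mul' g h := by
    apply LinearEquiv.toLinearMap_injective
    ext
    rfl

/-- The group `H`: the subgroup of `GL(V₁ ⊗ V₂ ⊗ V₃)` defined by `GL(V₁) × GL(V₂) × GL(V₃)`. -/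
noncomputable def groupH : Subgroup ((V₁ ⊗[F] (V₂ ⊗[F] V₃)) ≃ₗ[F] (V₁ ⊗[F] (V₂ ⊗[F] V₃))) :=
  (tensorAction F V₁ V₂ V₃).range

end

/-- The tensor space `F² ⊗ F³ ⊗ F³`. -/
abbrev Tensor233 (F : Type*) [Field F] : Type _ :=
  (Fin 2 → F) ⊗[F] ((Fin 3 → F) ⊗[F] (Fin 3 → F))

/-- The set of `H`-orbits on `F² ⊗ F³ ⊗ F³`, the orbit of the zero tensor included. -/
abbrev HOrbits233 (F : Type*) [Field F] : Type _ :=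
  MulAction.orbitRel.Quotient (groupH F (Fin 2 → F) (Fin 3 → F) (Fin 3 → F)) (Tensor233 F)

/-- The set of `G`-orbits on `F² ⊗ F³ ⊗ F³`, the orbit of the zero tensor included. -/
abbrev GOrbits233 (F : Type*) [Field F] : Type _ :=
  MulAction.orbitRel.Quotient (groupG F (Fin 2 → F) (Fin 3 → F) (Fin 3 → F)) (Tensor233 F)

end TensorOrbits

/-!
A tensor in `F² ⊗ F³ ⊗ F³` is a pair `(A, B)` of `3 × 3` matrices, and the `H`-orbits are the classes
of pencils `s A + t B` under row operations, column operations and linear substitutions of `(s, t)`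
(`mem_orbit_groupH_iff`). The classification of such pencils is Kronecker's, up to a change of
`(s, t)`.

*Every pencil has a normal form* (`NormalizesRootless.exists_normalForm`). Take a member of the pencil
as first slice and bring it to the form `diag(1, …, 1, 0, …, 0)`. If it has rank one or two, then what
is left is elimination and the similarity of `2 × 2` matrices. If it is invertible, and the
characteristic polynomial of the second slice has a root, then there is a singular member, so the
previous cases apply. Otherwise the pencil is `(1, companion matrix of a rootless cubic)`. The field
enters only through rootless quadratics and cubics, as recorded in `NormalizesRootless`. Over an
algebraically closed field there are none. Over `ℝ` there are no such cubics, and all such quadratics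
agree up to `x ↦ m x + l`. Over a finite field both exist, and since there is only one extension of
each degree, all such quadratics agree up to `x ↦ m x + l` and all such cubics up to a fractional
linear substitution (`exists_affine_of_finite`, `pencilEquiv_of_rootless_cubic`).

*The normal forms are inequivalent* (`NormalForm.eq_of_pencilEquiv`). They are separated by
existence statements about members of small rank and about simple and multiple roots of the
determinant, each visibly invariant under equivalence.

This gives `21`, `18` and `20` orbits of `H`. The two types with an irreducible quadratic factor and
the one with an irreducible cubic are all present over a finite field, all absent over an algebraically
closed one, and only the cubic one is absent over `ℝ`.

*The group `G`* is generated by `H` and the interchange of the two factors `F³`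
(`mem_groupH_or_swapTensor_mul_mem_groupH`). Two fundamental tensors whose sum is fundamental or zero
agree, up to scalars, in two of their three factors. Hence a three-dimensional space of fundamental
tensors has two fixed factors, one of them the first (`exists_factor_of_isPure`), and an automorphism that preserves fundamental tensors respects the families
`a ⊗ b ⊗ F³` and `a ⊗ F³ ⊗ c` up to interchange. On pencils the interchange is transposition, which
fixes all normal forms but three pairs, so `G` has three orbits less than `H`.
-/

open scoped TensorProduct Pointwise

namespace TensorOrbits

open Matrix

/-! ### Tensors as pencils of matrices -/

/-- A tensor in `F² ⊗ F³ ⊗ F³` in coordinates: the pair `(A, B)` of its two slices, thought of as the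
pencil `s A + t B` of `3 × 3` matrices. -/
abbrev Pencil (F : Type*) := Matrix (Fin 3) (Fin 3) F × Matrix (Fin 3) (Fin 3) F

section

variable {F : Type*} [Field F]

/-- Equivalence of pencils: invertible row and column operations on both slices, and an invertible
change `!![a, b; c, d]` of the two slices. -/
def PencilEquiv (X Y : Pencil F) : Prop :=
  ∃ (P Q : Matrix (Fin 3) (Fin 3) F) (a b c d : F), P.det ≠ 0 ∧ Q.det ≠ 0 ∧ a * d - b * c ≠ 0 ∧
    Y.1 = P * (a • X.1 + b • X.2) * Q ∧ Y.2 = P * (c • X.1 + d • X.2) * Q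

theorem PencilEquiv.refl (X : Pencil F) : PencilEquiv X X :=
  ⟨1, 1, 1, 0, 0, 1, by simp, by simp, by simp, by simp, by simp⟩

theorem PencilEquiv.trans {X Y Z : Pencil F} (h₁ : PencilEquiv X Y) (h₂ : PencilEquiv Y Z) :
    PencilEquiv X Z := by
  obtain ⟨P, Q, a, b, c, d, hP, hQ, hg, e₁, e₂⟩ := h₁
  obtain ⟨P', Q', a', b', c', d', hP', hQ', hg', e₁', e₂'⟩ := h₂
  refine ⟨P' * P, Q * Q', a' * a + b' * c, a' * b + b' * d, c' * a + d' * c, c' * b + d' * d,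
    by simp [hP, hP'], by simp [hQ, hQ'], ?_, ?_, ?_⟩
  · rw [show (a' * a + b' * c) * (c' * b + d' * d) - (a' * b + b' * d) * (c' * a + d' * c)
      = (a' * d' - b' * c') * (a * d - b * c) by ring]
    exact mul_ne_zero hg' hg
  · rw [e₁', e₁, e₂]
    simp only [Matrix.mul_add, Matrix.add_mul, Matrix.mul_smul, Matrix.smul_mul, Matrix.mul_assoc,
      smul_add, add_smul, smul_smul]
    abel
  · rw [e₂', e₁, e₂]
    simp only [Matrix.mul_add, Matrix.add_mul, Matrix.mul_smul, Matrix.smul_mul, Matrix.mul_assoc,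
      smul_add, add_smul, smul_smul]
    abel

theorem PencilEquiv.symm {X Y : Pencil F} (h : PencilEquiv X Y) : PencilEquiv Y X := by
  obtain ⟨P, Q, a, b, c, d, hP, hQ, hg, e₁, e₂⟩ := h
  have hPu : IsUnit P.det := isUnit_iff_ne_zero.2 hP
  have hQu : IsUnit Q.det := isUnit_iff_ne_zero.2 hQ
  have key : ∀ M : Matrix (Fin 3) (Fin 3) F, P⁻¹ * (P * M * Q) * Q⁻¹ = M := fun M => by
    rw [Matrix.mul_assoc P, Matrix.nonsing_inv_mul_cancel_left _ _ hPu,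
      Matrix.mul_nonsing_inv_cancel_right _ _ hQu]
  have hA : ∀ r s : F, P⁻¹ * (r • Y.1 + s • Y.2) * Q⁻¹ =
      r • (a • X.1 + b • X.2) + s • (c • X.1 + d • X.2) := fun r s => by
    have : r • Y.1 + s • Y.2 = P * (r • (a • X.1 + b • X.2) + s • (c • X.1 + d • X.2)) * Q := by
      rw [e₁, e₂]
      simp only [Matrix.mul_add, Matrix.add_mul, Matrix.mul_smul, Matrix.smul_mul]
    rw [this, key]
  obtain ⟨D, hD⟩ : ∃ D, D = a * d - b * c := ⟨_, rfl⟩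
  rw [← hD] at hg
  refine ⟨P⁻¹, Q⁻¹, d / D, -b / D, -c / D, a / D, ?_, ?_, ?_, ?_, ?_⟩
  · simpa [Matrix.det_nonsing_inv] using hP
  · simpa [Matrix.det_nonsing_inv] using hQ
  · have : d / D * (a / D) - -b / D * (-c / D) = D⁻¹ := by
      field_simp
      rw [hD]; ring
    rw [this]; exact inv_ne_zero hg
  · rw [hA]; ext i j
    simp only [Matrix.add_apply, Matrix.smul_apply, smul_eq_mul]; field_simp; rw [hD]; ring
  · rw [hA]; ext i j
    simp only [Matrix.add_apply, Matrix.smul_apply, smul_eq_mul]; field_simp; rw [hD]; ring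

theorem PencilEquiv.mul_mul (X : Pencil F) {P Q : Matrix (Fin 3) (Fin 3) F} (hP : P.det ≠ 0)
    (hQ : Q.det ≠ 0) : PencilEquiv X (P * X.1 * Q, P * X.2 * Q) :=
  ⟨P, Q, 1, 0, 0, 1, hP, hQ, by simp, by simp, by simp⟩

theorem PencilEquiv.mix (X : Pencil F) {a b c d : F} (h : a * d - b * c ≠ 0) :
    PencilEquiv X (a • X.1 + b • X.2, c • X.1 + d • X.2) :=
  ⟨1, 1, a, b, c, d, by simp, by simp, h, by simp, by simp⟩

/-- The form in which most explicit equivalences are given: `P X = Y Q` avoids all inverses. -/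
theorem PencilEquiv.of_mul_eq {X Y : Pencil F} (P Q : Matrix (Fin 3) (Fin 3) F) (a b c d : F)
    (hP : P.det ≠ 0) (hQ : Q.det ≠ 0) (hg : a * d - b * c ≠ 0)
    (h₁ : P * (a • X.1 + b • X.2) = Y.1 * Q) (h₂ : P * (c • X.1 + d • X.2) = Y.2 * Q) :
    PencilEquiv X Y := by
  have hQu : IsUnit Q.det := isUnit_iff_ne_zero.2 hQ
  refine ⟨P, Q⁻¹, a, b, c, d, hP, by simpa [Matrix.det_nonsing_inv] using hQ, hg, ?_, ?_⟩
  · rw [h₁, Matrix.mul_nonsing_inv_cancel_right _ _ hQu]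
  · rw [h₂, Matrix.mul_nonsing_inv_cancel_right _ _ hQu]

theorem PencilEquiv.transpose {X Y : Pencil F} (h : PencilEquiv X Y) :
    PencilEquiv (X.1ᵀ, X.2ᵀ) (Y.1ᵀ, Y.2ᵀ) := by
  obtain ⟨P, Q, a, b, c, d, hP, hQ, hg, e₁, e₂⟩ := h
  refine ⟨Qᵀ, Pᵀ, a, b, c, d, by simpa using hQ, by simpa using hP, hg, ?_, ?_⟩
  · simp [e₁, Matrix.mul_assoc]
  · simp [e₂, Matrix.mul_assoc]

variable (F) in
/-- The coordinates of a tensor, as a pencil. -/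
noncomputable def toPencil : Tensor233 F ≃ₗ[F] Pencil F :=
  ((Pi.basisFun F (Fin 2)).tensorProduct
    ((Pi.basisFun F (Fin 3)).tensorProduct (Pi.basisFun F (Fin 3)))).equivFun ≪≫ₗ
  { toFun := fun f => (Matrix.of fun j k => f (0, j, k), Matrix.of fun j k => f (1, j, k))
    invFun := fun X p => if p.1 = 0 then X.1 p.2.1 p.2.2 else X.2 p.2.1 p.2.2
    map_add' := fun _ _ => rfl
    map_smul' := fun _ _ => rfl
    left_inv := fun f => by
      funext ⟨i, j, k⟩
      fin_cases i <;> simp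
    right_inv := fun X => by
      ext <;> simp }

theorem toPencil_tmul (a : Fin 2 → F) (b c : Fin 3 → F) :
    toPencil F (a ⊗ₜ (b ⊗ₜ c)) = (a 0 • vecMulVec b c, a 1 • vecMulVec b c) := by
  let e := (Pi.basisFun F (Fin 2)).tensorProduct
    ((Pi.basisFun F (Fin 3)).tensorProduct (Pi.basisFun F (Fin 3)))
  have h : ∀ i j k, e.repr (a ⊗ₜ (b ⊗ₜ c)) (i, j, k) = a i * (b j * c k) := fun i j k => by
    simp [e]
    ring
  ext j k
  · exact (h 0 j k).trans (by simp [Matrix.vecMulVec_apply])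
  · exact (h 1 j k).trans (by simp [Matrix.vecMulVec_apply])

/-- Two linear maps on tensors agree as soon as they agree on pure tensors. -/
theorem tensor_hom_ext {W : Type*} [AddCommGroup W] [Module F W] {f g : Tensor233 F →ₗ[F] W}
    (h : ∀ a b c, f (a ⊗ₜ (b ⊗ₜ c)) = g (a ⊗ₜ (b ⊗ₜ c))) : f = g :=
  TensorProduct.ext <| LinearMap.ext fun a => TensorProduct.ext <| LinearMap.ext fun b =>
    LinearMap.ext fun c => h a b c

theorem toPencil_tensorAction (g : (((Fin 2 → F) ≃ₗ[F] (Fin 2 → F)) × ((Fin 3 → F) ≃ₗ[F] (Fin 3 → F))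
    × ((Fin 3 → F) ≃ₗ[F] (Fin 3 → F)))) (x : Tensor233 F) :
    toPencil F (tensorAction F _ _ _ g x) =
      (LinearMap.toMatrix' g.2.1.toLinearMap * (LinearMap.toMatrix' g.1.toLinearMap 0 0 • (toPencil F x).1
        + LinearMap.toMatrix' g.1.toLinearMap 0 1 • (toPencil F x).2) *
          (LinearMap.toMatrix' g.2.2.toLinearMap)ᵀ,
       LinearMap.toMatrix' g.2.1.toLinearMap * (LinearMap.toMatrix' g.1.toLinearMap 1 0 • (toPencil F x).1
        + LinearMap.toMatrix' g.1.toLinearMap 1 1 • (toPencil F x).2) *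
          (LinearMap.toMatrix' g.2.2.toLinearMap)ᵀ) := by
  obtain ⟨g₁, g₂, g₃⟩ := g
  set G := LinearMap.toMatrix' g₁.toLinearMap
  set P := LinearMap.toMatrix' g₂.toLinearMap
  set Q := LinearMap.toMatrix' g₃.toLinearMap
  let R : Pencil F →ₗ[F] Pencil F :=
    { toFun := fun X => (P * (G 0 0 • X.1 + G 0 1 • X.2) * Qᵀ, P * (G 1 0 • X.1 + G 1 1 • X.2) * Qᵀ)
      map_add' := fun X Y => by
        ext1 <;> simp only [Prod.fst_add, Prod.snd_add, smul_add, Matrix.mul_add, Matrix.add_mul] <;>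
          abel
      map_smul' := fun r X => by
        ext1 <;> simp [Matrix.mul_add, Matrix.add_mul, smul_comm r] }
  have hG : ∀ a, g₁ a = G *ᵥ a := fun a => by simp [G]
  have hP : ∀ a, g₂ a = P *ᵥ a := fun a => by simp [P]
  have hQ : ∀ a, g₃ a = Q *ᵥ a := fun a => by simp [Q]
  have key : (toPencil F).toLinearMap ∘ₗ (tensorAction F _ _ _ (g₁, g₂, g₃)).toLinearMap =
      R ∘ₗ (toPencil F).toLinearMap := by
    refine tensor_hom_ext fun a b c => ?_
    have : tensorAction F _ _ _ (g₁, g₂, g₃) (a ⊗ₜ (b ⊗ₜ c)) = g₁ a ⊗ₜ (g₂ b ⊗ₜ g₃ c) := rfl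
    simp only [LinearMap.comp_apply, LinearEquiv.coe_coe, this, toPencil_tmul]
    simp only [R, LinearMap.coe_mk, AddHom.coe_mk, smul_smul, ← add_smul]
    simp only [Matrix.mul_smul, Matrix.smul_mul, Matrix.mul_vecMulVec, Matrix.vecMulVec_mul,
      Matrix.vecMul_transpose, hG, hP, hQ]
    simp [Matrix.mulVec, dotProduct, Fin.sum_univ_two]
  exact LinearMap.congr_fun key x

/-- The `H`-orbits of tensors are the equivalence classes of pencils. -/
theorem mem_orbit_groupH_iff {x y : Tensor233 F} :
    y ∈ MulAction.orbit (groupH F (Fin 2 → F) (Fin 3 → F) (Fin 3 → F)) x ↔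
      PencilEquiv (toPencil F x) (toPencil F y) := by
  have hdet : ∀ {n : ℕ} (g : (Fin n → F) ≃ₗ[F] (Fin n → F)),
      (LinearMap.toMatrix' g.toLinearMap).det ≠ 0 := fun g => by
    rw [LinearMap.det_toMatrix']
    exact (LinearEquiv.isUnit_det' g).ne_zero
  constructor
  · rintro ⟨⟨_, g, rfl⟩, rfl⟩
    have := toPencil_tensorAction g x
    have hg := hdet g.1
    rw [Matrix.det_fin_two] at hg
    refine ⟨_, _, _, _, _, _, hdet g.2.1, ?_, hg, congrArg Prod.fst this, congrArg Prod.snd this⟩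
    rw [Matrix.det_transpose]
    exact hdet _
  · rintro ⟨P, Q, a, b, c, d, hP, hQ, hg, e₁, e₂⟩
    have hG : (!![a, b; c, d]).det ≠ 0 := by simpa [Matrix.det_fin_two] using hg
    have hQ' : Qᵀ.det ≠ 0 := by simpa using hQ
    refine ⟨⟨_, (LinearEquiv.ofIsUnitDet (f := Matrix.toLin' !![a, b; c, d])
        (v := Pi.basisFun F _) (v' := Pi.basisFun F _) ?_,
      LinearEquiv.ofIsUnitDet (f := Matrix.toLin' P) (v := Pi.basisFun F _) (v' := Pi.basisFun F _) ?_,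
      LinearEquiv.ofIsUnitDet (f := Matrix.toLin' Qᵀ) (v := Pi.basisFun F _) (v' := Pi.basisFun F _) ?_),
      rfl⟩, ?_⟩
    · simpa [LinearMap.toMatrix_eq_toMatrix'] using hG
    · simpa [LinearMap.toMatrix_eq_toMatrix'] using hP
    · simpa [LinearMap.toMatrix_eq_toMatrix'] using hQ
    · apply (toPencil F).injective
      have hc : ∀ {n : ℕ} (M : Matrix (Fin n) (Fin n) F) (h),
          (LinearEquiv.ofIsUnitDet (f := Matrix.toLin' M)
            (v := Pi.basisFun F _) (v' := Pi.basisFun F _) h).toLinearMap = Matrix.toLin' M :=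
        fun M h => rfl
      refine (toPencil_tensorAction _ x).trans ?_
      simp only [hc, LinearMap.toMatrix'_toLin', Matrix.transpose_transpose]
      exact (Prod.ext e₁ e₂).symm

/-- The linear automorphism of `F² ⊗ F³ ⊗ F³` exchanging the two factors `F³`. -/
noncomputable def swapTensor : Tensor233 F ≃ₗ[F] Tensor233 F :=
  TensorProduct.congr (LinearEquiv.refl F _) (TensorProduct.comm F _ _)

theorem toPencil_swapTensor (x : Tensor233 F) :
    toPencil F (swapTensor x) = ((toPencil F x).1ᵀ, (toPencil F x).2ᵀ) := by
  let R : Pencil F →ₗ[F] Pencil F :=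
    { toFun := fun X => (X.1ᵀ, X.2ᵀ)
      map_add' := fun _ _ => rfl
      map_smul' := fun _ _ => rfl }
  have key : (toPencil F).toLinearMap ∘ₗ swapTensor.toLinearMap =
      R ∘ₗ (toPencil F).toLinearMap := by
    refine tensor_hom_ext fun a b c => ?_
    have : swapTensor (a ⊗ₜ (b ⊗ₜ c)) = a ⊗ₜ[F] (c ⊗ₜ[F] b) := rfl
    simp only [LinearMap.comp_apply, LinearEquiv.coe_coe, this, toPencil_tmul]
    exact Prod.ext (show a 0 • vecMulVec c b = (a 0 • vecMulVec b c)ᵀ by simp)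
      (show a 1 • vecMulVec c b = (a 1 • vecMulVec b c)ᵀ by simp)
  exact LinearMap.congr_fun key x

end

/-! ### The normal forms -/

/-- Labels of the normal forms, after the Kronecker type of the pencil: `regular…` are the pencils whose
determinant is a non-zero cubic form, named by its roots; `square…` are the regular `2 × 2` pencils
padded by a zero row and a zero column; `L₁`, `L₂` are the singular blocks with one, two rows, `T` marks
a transposed block, and `J₁` is a regular block of size one. -/
inductive NormalForm
  | zero | rankOne | rankTwo | rankThree
  | regularDistinct | regularDoubleSplit | regularDouble | regularTriple | regularTripleSplit
  | regularQuadratic | regularCubic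
  | squareDistinct | squareDouble | squareQuadratic
  | L₁J₁ | L₁J₁T | L₁L₁T | L₂ | L₂T | L₁ | L₁T
  deriving DecidableEq

open NormalForm in
instance : Fintype NormalForm where
  elems := {zero, rankOne, rankTwo, rankThree, regularDistinct, regularDoubleSplit, regularDouble,
    regularTriple, regularTripleSplit, regularQuadratic, regularCubic, squareDistinct, squareDouble,
    squareQuadratic, L₁J₁, L₁J₁T, L₁L₁T, L₂, L₂T, L₁, L₁T}
  complete i := by cases i <;> decide

section

variable {F : Type*} [Field F]

open NormalForm in
/-- The normal forms. The quadratic types use `x² - x + δ` and the cubic type `x³ - x - γ`. All are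
symmetric in the two factors `F³`, except for three pairs that are interchanged. -/
def NormalForm.pencil (δ γ : F) : NormalForm → Pencil F
  | zero => (0, 0)
  | rankOne => (!![1, 0, 0; 0, 0, 0; 0, 0, 0], 0)
  | rankTwo => (!![1, 0, 0; 0, 1, 0; 0, 0, 0], 0)
  | rankThree => (!![1, 0, 0; 0, 1, 0; 0, 0, 1], 0)
  | regularDistinct => (!![1, 0, 0; 0, 0, 0; 0, 0, 1], !![0, 0, 0; 0, 1, 0; 0, 0, 1])
  | regularDoubleSplit => (!![1, 0, 0; 0, 1, 0; 0, 0, 0], !![0, 0, 0; 0, 0, 0; 0, 0, 1])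
  | regularDouble => (!![0, 1, 0; 1, 0, 0; 0, 0, 0], !![0, 0, 0; 0, 1, 0; 0, 0, 1])
  | regularTriple => (!![0, 0, 1; 0, 1, 0; 1, 0, 0], !![0, 0, 0; 0, 0, 1; 0, 1, 0])
  | regularTripleSplit => (!![0, 1, 0; 1, 0, 0; 0, 0, 1], !![0, 0, 0; 0, 1, 0; 0, 0, 0])
  | regularQuadratic => (!![0, 1, 0; 1, -1, 0; 0, 0, 0], !![1, 0, 0; 0, -δ, 0; 0, 0, 1])
  | regularCubic => (!![0, 0, 1; 0, 1, 0; 1, 0, 1], !![0, 1, 0; 1, 0, 1; 0, 1, γ])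
  | squareDistinct => (!![1, 0, 0; 0, 0, 0; 0, 0, 0], !![0, 0, 0; 0, 1, 0; 0, 0, 0])
  | squareDouble => (!![0, 1, 0; 1, 0, 0; 0, 0, 0], !![0, 0, 0; 0, 1, 0; 0, 0, 0])
  | squareQuadratic => (!![0, 1, 0; 1, -1, 0; 0, 0, 0], !![1, 0, 0; 0, -δ, 0; 0, 0, 0])
  | L₁J₁ => (!![1, 0, 0; 0, 0, 1; 0, 0, 0], !![0, 1, 0; 0, 0, 0; 0, 0, 0])
  | L₁J₁T => (!![1, 0, 0; 0, 0, 0; 0, 1, 0], !![0, 0, 0; 1, 0, 0; 0, 0, 0])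
  | L₁L₁T => (!![0, 0, 1; 0, 0, 0; 1, 0, 0], !![0, 0, 0; 0, 0, 1; 0, 1, 0])
  | L₂ => (!![1, 0, 0; 0, 1, 0; 0, 0, 0], !![0, 1, 0; 0, 0, 1; 0, 0, 0])
  | L₂T => (!![1, 0, 0; 0, 1, 0; 0, 0, 0], !![0, 0, 0; 1, 0, 0; 0, 1, 0])
  | L₁ => (!![1, 0, 0; 0, 0, 0; 0, 0, 0], !![0, 1, 0; 0, 0, 0; 0, 0, 0])
  | L₁T => (!![1, 0, 0; 0, 0, 0; 0, 0, 0], !![0, 0, 0; 1, 0, 0; 0, 0, 0])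

/-- The type of the transposed pencil. -/
def NormalForm.transpose : NormalForm → NormalForm
  | L₁J₁ => L₁J₁T
  | L₁J₁T => L₁J₁
  | L₂ => L₂T
  | L₂T => L₂
  | L₁ => L₁T
  | L₁T => L₁
  | i => i

theorem NormalForm.pencil_transpose (δ γ : F) (i : NormalForm) :
    i.transpose.pencil δ γ = ((i.pencil δ γ).1ᵀ, (i.pencil δ γ).2ᵀ) := by
  cases i <;> ext j k <;> fin_cases j <;> fin_cases k <;> rfl

/-! ### Invariants of pencils -/

/-- Rank at most one. -/
def IsRankLeOne (M : Matrix (Fin 3) (Fin 3) F) : Prop := ∃ u v, M = vecMulVec u v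

theorem IsRankLeOne.minor {M : Matrix (Fin 3) (Fin 3) F} (h : IsRankLeOne M) (i j k l : Fin 3) :
    M i j * M k l = M i l * M k j := by
  obtain ⟨u, v, rfl⟩ := h
  simp only [Matrix.vecMulVec_apply]
  ring

/-- Names of the invariants that separate the normal forms. -/
inductive Invariant
  | vanishes | dependent | rowDegenerate | colDegenerate | allRankLeOne | commonColumn
  | rankOneMember | twoRankOneMembers | multipleRoot | simpleRoot | twoSingularMembers
  deriving DecidableEq

/-- The invariants. A root is a singular member `M = s A + t B` with `M x = 0` and `y M = 0`; it is
multiple if `y N x = 0` for all members `N`, with `x` and `y` nonzero, and simple if `y N x ≠ 0` for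
some member `N`. This makes sense over every field, also where the determinant has too few values. -/
def Invariant.holds (X : Pencil F) : Invariant → Prop
  | vanishes => X.1 = 0 ∧ X.2 = 0
  | dependent => ∃ s t : F, (s ≠ 0 ∨ t ≠ 0) ∧ s • X.1 + t • X.2 = 0
  | rowDegenerate => ∃ y, y ≠ 0 ∧ y ᵥ* X.1 = 0 ∧ y ᵥ* X.2 = 0
  | colDegenerate => ∃ x, x ≠ 0 ∧ X.1 *ᵥ x = 0 ∧ X.2 *ᵥ x = 0
  | allRankLeOne => ∀ s t : F, IsRankLeOne (s • X.1 + t • X.2)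
  | commonColumn => ∃ u v w, X.1 = vecMulVec u v ∧ X.2 = vecMulVec u w
  | rankOneMember => ∃ s t : F, (s ≠ 0 ∨ t ≠ 0) ∧ IsRankLeOne (s • X.1 + t • X.2)
  | twoRankOneMembers => ∃ s t s' t' : F, s * t' - t * s' ≠ 0 ∧
      IsRankLeOne (s • X.1 + t • X.2) ∧ IsRankLeOne (s' • X.1 + t' • X.2)
  | multipleRoot => ∃ s t : F, (s ≠ 0 ∨ t ≠ 0) ∧ ∃ x y, x ≠ 0 ∧ y ≠ 0 ∧
      (s • X.1 + t • X.2) *ᵥ x = 0 ∧ y ᵥ* (s • X.1 + t • X.2) = 0 ∧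
      y ⬝ᵥ X.1 *ᵥ x = 0 ∧ y ⬝ᵥ X.2 *ᵥ x = 0
  | simpleRoot => ∃ s t : F, (s ≠ 0 ∨ t ≠ 0) ∧ ∃ x y,
      (s • X.1 + t • X.2) *ᵥ x = 0 ∧ y ᵥ* (s • X.1 + t • X.2) = 0 ∧
      ¬ (y ⬝ᵥ X.1 *ᵥ x = 0 ∧ y ⬝ᵥ X.2 *ᵥ x = 0)
  | twoSingularMembers => ∃ s t s' t' : F, s * t' - t * s' ≠ 0 ∧
      (s • X.1 + t • X.2).det = 0 ∧ (s' • X.1 + t' • X.2).det = 0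

theorem Invariant.holds_of_pencilEquiv {X Y : Pencil F} (h : PencilEquiv X Y) (k : Invariant)
    (hY : k.holds Y) : k.holds X := by
  obtain ⟨P, Q, a, b, c, d, hP, hQ, hg, e₁, e₂⟩ := h
  have hPu : IsUnit P.det := isUnit_iff_ne_zero.2 hP
  have hQu : IsUnit Q.det := isUnit_iff_ne_zero.2 hQ
  have hcancel : ∀ M, P⁻¹ * (P * M * Q) * Q⁻¹ = M := fun M => by
    rw [Matrix.mul_assoc P, Matrix.nonsing_inv_mul_cancel_left _ _ hPu,
      Matrix.mul_nonsing_inv_cancel_right _ _ hQu]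
  have hmem : ∀ s t : F, s • Y.1 + t • Y.2 =
      P * ((s * a + t * c) • X.1 + (s * b + t * d) • X.2) * Q := fun s t => by
    rw [e₁, e₂]
    simp only [Matrix.mul_add, Matrix.add_mul, Matrix.mul_smul, Matrix.smul_mul, smul_add, add_smul,
      smul_smul]
    abel
  have hsolve : ∀ {W : Type _} [AddCommGroup W] [Module F W] {p q : W},
      a • p + b • q = 0 → c • p + d • q = 0 → p = 0 ∧ q = 0 := by
    intro W _ _ p q h₁ h₂
    constructor
    · refine (smul_eq_zero.1 (?_ : (a * d - b * c) • p = 0)).resolve_left hg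
      linear_combination (norm := module) d • h₁ - b • h₂
    · refine (smul_eq_zero.1 (?_ : (a * d - b * c) • q = 0)).resolve_left hg
      linear_combination (norm := module) a • h₂ - c • h₁
  have hne : ∀ s t : F, (s ≠ 0 ∨ t ≠ 0) → (s * a + t * c ≠ 0 ∨ s * b + t * d ≠ 0) := by
    intro s t hst
    by_contra! hcon
    have h1 : s * (a * d - b * c) = 0 := by linear_combination d * hcon.1 - c * hcon.2
    have h2 : t * (a * d - b * c) = 0 := by linear_combination a * hcon.2 - b * hcon.1
    rcases hst with hs | ht
    · exact hs ((mul_eq_zero.1 h1).resolve_right hg)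
    · exact ht ((mul_eq_zero.1 h2).resolve_right hg)
  have hdet : ∀ s t s' t' : F, s * t' - t * s' ≠ 0 →
      (s * a + t * c) * (s' * b + t' * d) - (s * b + t * d) * (s' * a + t' * c) ≠ 0 := by
    intro s t s' t' hst
    rw [show (s * a + t * c) * (s' * b + t' * d) - (s * b + t * d) * (s' * a + t' * c)
      = (s * t' - t * s') * (a * d - b * c) by ring]
    exact mul_ne_zero hst hg
  have hrk : ∀ M, IsRankLeOne (P * M * Q) → IsRankLeOne M := by
    rintro M ⟨u, v, huv⟩
    refine ⟨P⁻¹ *ᵥ u, v ᵥ* Q⁻¹, ?_⟩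
    rw [← hcancel M, huv, Matrix.mul_vecMulVec, Matrix.vecMulVec_mul]
  have hcol : ∀ (M : Matrix (Fin 3) (Fin 3) F) x, (P * M * Q) *ᵥ x = 0 → M *ᵥ (Q *ᵥ x) = 0 := by
    intro M x hx
    apply Matrix.eq_zero_of_mulVec_eq_zero hP
    simpa [Matrix.mulVec_mulVec, Matrix.mul_assoc] using hx
  have hrow : ∀ (M : Matrix (Fin 3) (Fin 3) F) y, y ᵥ* (P * M * Q) = 0 → (y ᵥ* P) ᵥ* M = 0 := by
    intro M x hx
    apply Matrix.eq_zero_of_vecMul_eq_zero hQ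
    simpa [Matrix.vecMul_vecMul, Matrix.mul_assoc] using hx
  have hpair : ∀ (M : Matrix (Fin 3) (Fin 3) F) x y,
      y ⬝ᵥ (P * M * Q) *ᵥ x = (y ᵥ* P) ⬝ᵥ M *ᵥ (Q *ᵥ x) := by
    intro M x y
    simp only [← Matrix.mulVec_mulVec, Matrix.dotProduct_mulVec, Matrix.vecMul_vecMul]
  have hx0 : ∀ x, x ≠ 0 → Q *ᵥ x ≠ 0 := fun x hx h0 => hx (Matrix.eq_zero_of_mulVec_eq_zero hQ h0)
  have hy0 : ∀ y, y ≠ 0 → y ᵥ* P ≠ 0 := fun y hy h0 => hy (Matrix.eq_zero_of_vecMul_eq_zero hP h0)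
  have hzero : ∀ M, P * M * Q = 0 → M = 0 := fun M hM => by rw [← hcancel M, hM]; simp
  obtain ⟨D, hD⟩ : ∃ D, D = a * d - b * c := ⟨_, rfl⟩
  rw [← hD] at hg
  cases k with
  | vanishes =>
    obtain ⟨h₁, h₂⟩ := hY
    rw [e₁] at h₁
    rw [e₂] at h₂
    exact hsolve (hzero _ h₁) (hzero _ h₂)
  | dependent =>
    obtain ⟨s, t, hst, h0⟩ := hY
    rw [hmem] at h0
    exact ⟨_, _, hne s t hst, hzero _ h0⟩
  | rowDegenerate =>
    obtain ⟨y, hy, h₁, h₂⟩ := hY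
    rw [e₁] at h₁
    rw [e₂] at h₂
    refine ⟨y ᵥ* P, hy0 y hy, hsolve ?_ ?_⟩
    · simpa only [Matrix.vecMul_add, Matrix.vecMul_smul] using hrow _ _ h₁
    · simpa only [Matrix.vecMul_add, Matrix.vecMul_smul] using hrow _ _ h₂
  | colDegenerate =>
    obtain ⟨x, hx, h₁, h₂⟩ := hY
    rw [e₁] at h₁
    rw [e₂] at h₂
    refine ⟨Q *ᵥ x, hx0 x hx, hsolve ?_ ?_⟩
    · simpa only [Matrix.add_mulVec, Matrix.smul_mulVec] using hcol _ _ h₁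
    · simpa only [Matrix.add_mulVec, Matrix.smul_mulVec] using hcol _ _ h₂
  | allRankLeOne =>
    intro s t
    have h0 := hY ((d * s - c * t) / D) ((a * t - b * s) / D)
    rw [hmem] at h0
    convert hrk _ h0 using 3
    · field_simp; rw [hD]; ring
    · field_simp; rw [hD]; ring
  | commonColumn =>
    obtain ⟨u, v, w, h₁, h₂⟩ := hY
    have h : ∀ s t : F, (s * a + t * c) • X.1 + (s * b + t * d) • X.2 =
        vecMulVec (P⁻¹ *ᵥ u) ((s • v + t • w) ᵥ* Q⁻¹) := fun s t => by
      rw [← hcancel ((s * a + t * c) • X.1 + (s * b + t * d) • X.2), ← hmem, h₁, h₂,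
        ← Matrix.vecMulVec_smul, ← Matrix.vecMulVec_smul, ← Matrix.vecMulVec_add,
        Matrix.mul_vecMulVec, Matrix.vecMulVec_mul]
    refine ⟨P⁻¹ *ᵥ u, ((d / D) • v + (-b / D) • w) ᵥ* Q⁻¹, ((-c / D) • v + (a / D) • w) ᵥ* Q⁻¹,
      ?_, ?_⟩
    · rw [← h (d / D) (-b / D)]
      ext i j
      simp only [Matrix.add_apply, Matrix.smul_apply, smul_eq_mul]
      field_simp
      rw [hD]
      ring
    · rw [← h (-c / D) (a / D)]
      ext i j
      simp only [Matrix.add_apply, Matrix.smul_apply, smul_eq_mul]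
      field_simp
      rw [hD]
      ring
  | rankOneMember =>
    obtain ⟨s, t, hst, h0⟩ := hY
    rw [hmem] at h0
    exact ⟨_, _, hne s t hst, hrk _ h0⟩
  | twoRankOneMembers =>
    obtain ⟨s, t, s', t', hst, h₁, h₂⟩ := hY
    rw [hmem] at h₁ h₂
    exact ⟨_, _, _, _, hdet _ _ _ _ hst, hrk _ h₁, hrk _ h₂⟩
  | multipleRoot =>
    obtain ⟨s, t, hst, x, y, hx, hy, hMx, hyM, h₁, h₂⟩ := hY
    rw [hmem] at hMx hyM
    rw [e₁, hpair] at h₁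
    rw [e₂, hpair] at h₂
    refine ⟨_, _, hne s t hst, _, _, hx0 x hx, hy0 y hy, hcol _ _ hMx, hrow _ _ hyM, hsolve ?_ ?_⟩
    · simpa only [Matrix.add_mulVec, Matrix.smul_mulVec, dotProduct_add, dotProduct_smul] using h₁
    · simpa only [Matrix.add_mulVec, Matrix.smul_mulVec, dotProduct_add, dotProduct_smul] using h₂
  | simpleRoot =>
    obtain ⟨s, t, hst, x, y, hMx, hyM, h⟩ := hY
    rw [hmem] at hMx hyM
    rw [e₁, e₂, hpair, hpair] at h
    refine ⟨_, _, hne s t hst, _, _, hcol _ _ hMx, hrow _ _ hyM, fun h' => h ?_⟩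
    simp only [Matrix.add_mulVec, Matrix.smul_mulVec, dotProduct_add, dotProduct_smul, h'.1, h'.2]
    simp
  | twoSingularMembers =>
    obtain ⟨s, t, s', t', hst, h₁, h₂⟩ := hY
    rw [hmem] at h₁ h₂
    simp only [Matrix.det_mul, mul_eq_zero, hP, hQ, false_or, or_false] at h₁ h₂
    exact ⟨_, _, _, _, hdet _ _ _ _ hst, h₁, h₂⟩

theorem Invariant.holds_iff_of_pencilEquiv {X Y : Pencil F} (h : PencilEquiv X Y) (k : Invariant) :
    k.holds X ↔ k.holds Y :=
  ⟨holds_of_pencilEquiv h.symm k, holds_of_pencilEquiv h k⟩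

open NormalForm Invariant in
/-- Enough values of the invariants to tell the normal forms apart. -/
def NormalForm.values : NormalForm → List (Invariant × Bool)
  | zero => [(vanishes, true), (dependent, true)]
  | rankOne => [(vanishes, false), (dependent, true), (allRankLeOne, true)]
  | rankTwo => [(vanishes, false), (dependent, true), (allRankLeOne, false), (rowDegenerate, true)]
  | rankThree => [(vanishes, false), (dependent, true), (allRankLeOne, false), (rowDegenerate, false)]
  | regularDistinct => [(dependent, false), (rowDegenerate, false), (colDegenerate, false),
      (rankOneMember, false), (twoSingularMembers, true), (multipleRoot, false)]
  | regularDoubleSplit => [(dependent, false), (rowDegenerate, false), (colDegenerate, false),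
      (rankOneMember, true), (twoSingularMembers, true)]
  | regularDouble => [(dependent, false), (rowDegenerate, false), (colDegenerate, false),
      (rankOneMember, false), (twoSingularMembers, true), (multipleRoot, true), (simpleRoot, true)]
  | regularTriple => [(dependent, false), (rowDegenerate, false), (colDegenerate, false),
      (rankOneMember, false), (twoSingularMembers, false), (multipleRoot, true)]
  | regularTripleSplit => [(dependent, false), (rowDegenerate, false), (colDegenerate, false),
      (rankOneMember, true), (twoSingularMembers, false)]
  | regularQuadratic => [(dependent, false), (rowDegenerate, false), (colDegenerate, false),
      (rankOneMember, false), (twoSingularMembers, false), (multipleRoot, false), (simpleRoot, true)]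
  | regularCubic => [(dependent, false), (rowDegenerate, false), (colDegenerate, false),
      (rankOneMember, false), (twoSingularMembers, false), (multipleRoot, false), (simpleRoot, false)]
  | squareDistinct => [(dependent, false), (rowDegenerate, true), (colDegenerate, true),
      (allRankLeOne, false), (rankOneMember, true), (twoRankOneMembers, true)]
  | squareDouble => [(dependent, false), (rowDegenerate, true), (colDegenerate, true),
      (allRankLeOne, false), (rankOneMember, true), (twoRankOneMembers, false)]
  | squareQuadratic => [(dependent, false), (rowDegenerate, true), (colDegenerate, true),
      (allRankLeOne, false), (rankOneMember, false)]
  | L₁J₁ => [(dependent, false), (rowDegenerate, true), (colDegenerate, false), (rankOneMember, true)]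
  | L₁J₁T => [(dependent, false), (rowDegenerate, false), (colDegenerate, true), (rankOneMember, true)]
  | L₁L₁T => [(dependent, false), (rowDegenerate, false), (colDegenerate, false),
      (rankOneMember, false), (twoSingularMembers, true), (multipleRoot, true), (simpleRoot, false)]
  | L₂ => [(dependent, false), (rowDegenerate, true), (colDegenerate, false), (rankOneMember, false)]
  | L₂T => [(dependent, false), (rowDegenerate, false), (colDegenerate, true), (rankOneMember, false)]
  | L₁ => [(dependent, false), (rowDegenerate, true), (colDegenerate, true), (allRankLeOne, true),
      (commonColumn, true)]
  | L₁T => [(dependent, false), (rowDegenerate, true), (colDegenerate, true), (allRankLeOne, true),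
      (commonColumn, false)]

theorem NormalForm.exists_values_ne : ∀ i j : NormalForm, i ≠ j →
    ∃ p ∈ i.values, (p.1, !p.2) ∈ j.values := by
  decide

/-- The polynomial behind the label, if there is one, has no root. Without this, the pencils of the
quadratic and cubic types are equivalent to other normal forms. -/
def NormalForm.Admissible (δ γ : F) : NormalForm → Prop
  | regularQuadratic | squareQuadratic => ∀ x : F, x ^ 2 - x + δ ≠ 0
  | regularCubic => ∀ x : F, x ^ 3 - x - γ ≠ 0
  | _ => True

/-- A rootless quadratic has no projective zero. -/
theorem quadratic_form_eq_zero {δ : F} (h : ∀ x : F, x ^ 2 - x + δ ≠ 0) {s t : F}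
    (h0 : s ^ 2 + s * t + δ * t ^ 2 = 0) : s = 0 ∧ t = 0 := by
  by_cases ht : t = 0
  · subst ht
    simpa using h0
  · refine absurd ?_ (h (-s / t))
    field_simp
    linear_combination h0

/-- A rootless cubic has no projective zero. -/
theorem cubic_form_eq_zero {γ : F} (h : ∀ x : F, x ^ 3 - x - γ ≠ 0) {s t : F}
    (h0 : s ^ 3 - s * t ^ 2 + γ * t ^ 3 = 0) : s = 0 ∧ t = 0 := by
  by_cases ht : t = 0
  · subst ht
    simpa using h0
  · refine absurd ?_ (h (-s / t))
    field_simp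
    linear_combination -h0

set_option maxHeartbeats 2000000 in
theorem NormalForm.not_dependent (δ γ : F) (i : NormalForm)
    (h : (Invariant.dependent, false) ∈ i.values) :
    ¬ Invariant.dependent.holds (i.pencil δ γ) := by
  rintro ⟨s, t, hst, h0⟩
  have h1 := fun j k => congrFun (congrFun h0 j) k
  cases i <;> first | (exfalso; revert h; decide) | skip
  all_goals
    simp [NormalForm.pencil, Fin.forall_fin_succ] at h1
    simp_all

set_option maxHeartbeats 2000000 in
theorem NormalForm.not_rowDegenerate (δ γ : F) (i : NormalForm)
    (h : (Invariant.rowDegenerate, false) ∈ i.values) :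
    ¬ Invariant.rowDegenerate.holds (i.pencil δ γ) := by
  rintro ⟨y, hy, h1, h2⟩
  apply hy
  replace h1 := fun j => congrFun h1 j
  replace h2 := fun j => congrFun h2 j
  suffices y 0 = 0 ∧ y 1 = 0 ∧ y 2 = 0 by
    ext j; fin_cases j <;> simp [this]
  cases i <;> first | (exfalso; revert h; decide) | skip
  all_goals
    simp [NormalForm.pencil, Fin.forall_fin_succ, Matrix.vecMul, dotProduct, Fin.sum_univ_three] at h1 h2
    simp_all

set_option maxHeartbeats 2000000 in
theorem NormalForm.not_colDegenerate (δ γ : F) (i : NormalForm)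
    (h : (Invariant.colDegenerate, false) ∈ i.values) :
    ¬ Invariant.colDegenerate.holds (i.pencil δ γ) := by
  rintro ⟨y, hy, h1, h2⟩
  apply hy
  replace h1 := fun j => congrFun h1 j
  replace h2 := fun j => congrFun h2 j
  suffices y 0 = 0 ∧ y 1 = 0 ∧ y 2 = 0 by
    ext j; fin_cases j <;> simp [this]
  cases i <;> first | (exfalso; revert h; decide) | skip
  all_goals
    simp [NormalForm.pencil, Fin.forall_fin_succ, Matrix.mulVec, dotProduct, Fin.sum_univ_three] at h1 h2
    simp_all

theorem NormalForm.not_rankOneMember (δ γ : F) (i : NormalForm)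
    (h : (Invariant.rankOneMember, false) ∈ i.values)
    (ha : i.Admissible δ γ) :
    ¬ Invariant.rankOneMember.holds (i.pencil δ γ) := by
  rintro ⟨s, t, hst, h0⟩
  have h1 := h0.minor
  cases i <;> first | (exfalso; revert h; decide) | skip
  case squareQuadratic | regularQuadratic =>
    have h2 := h1 0 0 1 1
    simp [NormalForm.pencil] at h2
    have := quadratic_form_eq_zero ha (s := s) (t := t) (by linear_combination -h2)
    simp_all
  case regularCubic =>
    have h2 := h1 0 0 1 1
    have h3 := h1 0 1 1 2
    simp [NormalForm.pencil] at h2 h3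
    simp_all
  all_goals
    simp [NormalForm.pencil, Fin.forall_fin_succ] at h1
    grind

theorem NormalForm.not_allRankLeOne (δ γ : F) (i : NormalForm)
    (h : (Invariant.allRankLeOne, false) ∈ i.values) :
    ¬ Invariant.allRankLeOne.holds (i.pencil δ γ) := by
  intro h0
  have h1 := (h0 1 0).minor 0 0 1 1
  have h2 := (h0 1 1).minor 0 0 1 1
  cases i <;> first | (exfalso; revert h; decide) | simp [NormalForm.pencil] at h1 h2

theorem NormalForm.allRankLeOne (δ γ : F) (i : NormalForm)
    (h : (Invariant.allRankLeOne, true) ∈ i.values) :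
    Invariant.allRankLeOne.holds (i.pencil δ γ) := by
  intro s t
  cases i <;> first | (exfalso; revert h; decide) | skip
  case rankOne =>
    refine ⟨![s, 0, 0], ![1, 0, 0], ?_⟩
    ext j k; fin_cases j <;> fin_cases k <;> simp [NormalForm.pencil, vecMulVec_apply]
  case L₁ =>
    refine ⟨![1, 0, 0], ![s, t, 0], ?_⟩
    ext j k; fin_cases j <;> fin_cases k <;> simp [NormalForm.pencil, vecMulVec_apply]
  case L₁T =>
    refine ⟨![s, t, 0], ![1, 0, 0], ?_⟩
    ext j k; fin_cases j <;> fin_cases k <;> simp [NormalForm.pencil, vecMulVec_apply]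

theorem NormalForm.rowDegenerate (δ γ : F) (i : NormalForm)
    (h : (Invariant.rowDegenerate, true) ∈ i.values) :
    Invariant.rowDegenerate.holds (i.pencil δ γ) := by
  refine ⟨![0, 0, 1], by simp, ?_⟩
  cases i <;> first
    | (exfalso; revert h; decide)
    | exact ⟨by ext j; fin_cases j <;> simp [NormalForm.pencil],
      by ext j; fin_cases j <;> simp [NormalForm.pencil]⟩

theorem NormalForm.colDegenerate (δ γ : F) (i : NormalForm)
    (h : (Invariant.colDegenerate, true) ∈ i.values) :
    Invariant.colDegenerate.holds (i.pencil δ γ) := by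
  refine ⟨![0, 0, 1], by simp, ?_⟩
  cases i <;> first
    | (exfalso; revert h; decide)
    | exact ⟨by ext j; fin_cases j <;> simp [NormalForm.pencil],
      by ext j; fin_cases j <;> simp [NormalForm.pencil]⟩

theorem NormalForm.rankOneMember (δ γ : F) (i : NormalForm)
    (h : (Invariant.rankOneMember, true) ∈ i.values) :
    Invariant.rankOneMember.holds (i.pencil δ γ) := by
  refine ⟨0, 1, by simp, ?_⟩
  cases i <;> first | (exfalso; revert h; decide) | skip
  case regularDoubleSplit =>
    refine ⟨![0, 0, 1], ![0, 0, 1], ?_⟩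
    ext j k; fin_cases j <;> fin_cases k <;> simp [NormalForm.pencil, vecMulVec_apply]
  case L₁J₁ =>
    refine ⟨![1, 0, 0], ![0, 1, 0], ?_⟩
    ext j k; fin_cases j <;> fin_cases k <;> simp [NormalForm.pencil, vecMulVec_apply]
  case L₁J₁T =>
    refine ⟨![0, 1, 0], ![1, 0, 0], ?_⟩
    ext j k; fin_cases j <;> fin_cases k <;> simp [NormalForm.pencil, vecMulVec_apply]
  all_goals
    refine ⟨![0, 1, 0], ![0, 1, 0], ?_⟩
    ext j k; fin_cases j <;> fin_cases k <;> simp [NormalForm.pencil, vecMulVec_apply]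

theorem NormalForm.twoSingularMembers (δ γ : F) (i : NormalForm)
    (h : (Invariant.twoSingularMembers, true) ∈ i.values) :
    Invariant.twoSingularMembers.holds (i.pencil δ γ) := by
  refine ⟨0, 1, 1, 0, by simp, ?_⟩
  cases i <;> first
    | (exfalso; revert h; decide)
    | simp [NormalForm.pencil, Matrix.det_fin_three]

theorem det_regularCubic (δ γ s t : F) : (s • (NormalForm.regularCubic.pencil δ γ).1 +
    t • (NormalForm.regularCubic.pencil δ γ).2).det = -(s ^ 3 - s * t ^ 2 + γ * t ^ 3) := by
  simp [NormalForm.pencil, Matrix.det_fin_three]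
  ring

theorem det_regularCubic_ne_zero {δ γ s t : F} (h : ∀ x : F, x ^ 3 - x - γ ≠ 0)
    (hst : s ≠ 0 ∨ t ≠ 0) : (s • (NormalForm.regularCubic.pencil δ γ).1 +
    t • (NormalForm.regularCubic.pencil δ γ).2).det ≠ 0 := by
  intro h0
  rw [det_regularCubic, neg_eq_zero] at h0
  have := cubic_form_eq_zero h h0
  simp_all

theorem NormalForm.not_twoSingularMembers (δ γ : F) (i : NormalForm)
    (h : (Invariant.twoSingularMembers, false) ∈ i.values)
    (ha : i.Admissible δ γ) :
    ¬ Invariant.twoSingularMembers.holds (i.pencil δ γ) := by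
  rintro ⟨s, t, s', t', hst, h1, h2⟩
  cases i <;> first | (exfalso; revert h; decide) | skip
  case regularCubic =>
    refine det_regularCubic_ne_zero (δ := δ) ha (s := s) (t := t) ?_ h1
    by_contra! hcon
    simp [hcon] at hst
  case regularQuadratic =>
    have hd : ∀ s t : F, (s • (NormalForm.regularQuadratic.pencil δ γ).1 +
      t • (NormalForm.regularQuadratic.pencil δ γ).2).det = - t * (s ^ 2 + s * t + δ * t ^ 2) := by
      intro s t; simp [NormalForm.pencil, Matrix.det_fin_three]; ring
    rw [hd] at h1 h2
    have key : ∀ s t : F, - t * (s ^ 2 + s * t + δ * t ^ 2) = 0 → t = 0 := by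
      intro s t h
      rcases mul_eq_zero.1 h with h | h
      · simpa using h
      · exact (quadratic_form_eq_zero ha h).2
    simp [key _ _ h1, key _ _ h2] at hst
  all_goals
    simp [NormalForm.pencil, Matrix.det_fin_three] at h1 h2
    simp [h1, h2] at hst

theorem NormalForm.multipleRoot (δ γ : F) (i : NormalForm)
    (h : (Invariant.multipleRoot, true) ∈ i.values) :
    Invariant.multipleRoot.holds (i.pencil δ γ) := by
  cases i <;> first | (exfalso; revert h; decide) | skip
  case L₁L₁T =>
    refine ⟨1, 0, by simp, ![0, 1, 0], ![0, 1, 0], by simp, by simp, ?_⟩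
    refine ⟨by ext j; fin_cases j <;> simp [NormalForm.pencil],
      by ext j; fin_cases j <;> simp [NormalForm.pencil], ?_⟩
    simp [NormalForm.pencil, Matrix.mulVec, dotProduct, Fin.sum_univ_three]
  all_goals
    refine ⟨0, 1, by simp, ![1, 0, 0], ![1, 0, 0], by simp, by simp, ?_⟩
    refine ⟨by ext j; fin_cases j <;> simp [NormalForm.pencil],
      by ext j; fin_cases j <;> simp [NormalForm.pencil], ?_⟩
    simp [NormalForm.pencil, Matrix.mulVec, dotProduct, Fin.sum_univ_three]

theorem NormalForm.simpleRoot (δ γ : F) (i : NormalForm)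
    (h : (Invariant.simpleRoot, true) ∈ i.values) :
    Invariant.simpleRoot.holds (i.pencil δ γ) := by
  refine ⟨1, 0, by simp, ![0, 0, 1], ![0, 0, 1], ?_⟩
  cases i <;> first | (exfalso; revert h; decide) | skip
  all_goals
    refine ⟨by ext j; fin_cases j <;> simp [NormalForm.pencil],
      by ext j; fin_cases j <;> simp [NormalForm.pencil], ?_⟩
    simp [NormalForm.pencil, Matrix.mulVec, dotProduct, Fin.sum_univ_three]

theorem NormalForm.not_multipleRoot (δ γ : F) (i : NormalForm)
    (h : (Invariant.multipleRoot, false) ∈ i.values)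
    (ha : i.Admissible δ γ) :
    ¬ Invariant.multipleRoot.holds (i.pencil δ γ) := by
  rintro ⟨s, t, hst, x, y, hx, hy, h1, h2, h3, h4⟩
  have hx' : ¬ (x 0 = 0 ∧ x 1 = 0 ∧ x 2 = 0) := fun h => hx (by ext j; fin_cases j <;> simp [h])
  have hy' : ¬ (y 0 = 0 ∧ y 1 = 0 ∧ y 2 = 0) := fun h => hy (by ext j; fin_cases j <;> simp [h])
  cases i <;> first | (exfalso; revert h; decide) | skip
  case regularCubic =>
    exact hx (Matrix.eq_zero_of_mulVec_eq_zero (det_regularCubic_ne_zero ha hst) h1)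
  all_goals
    replace h1 := fun j => congrFun h1 j
    replace h2 := fun j => congrFun h2 j
    simp [NormalForm.pencil, Fin.forall_fin_succ, Matrix.vecMul, Matrix.mulVec, dotProduct,
      Fin.sum_univ_three] at h1 h2 h3 h4
  case regularQuadratic =>
    have hq : s ^ 2 + s * t + δ * t ^ 2 ≠ 0 := fun h0 => by
      have := quadratic_form_eq_zero ha h0
      simp_all
    obtain ⟨h11, h12, -⟩ := h1
    obtain ⟨h21, h22, -⟩ := h2
    have e₁ : x 0 = 0 := (mul_eq_zero.1 (show (s ^ 2 + s * t + δ * t ^ 2) * x 0 = 0 by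
      linear_combination (s + t * δ) * h11 + s * h12)).resolve_left hq
    have e₂ : x 1 = 0 := (mul_eq_zero.1 (show (s ^ 2 + s * t + δ * t ^ 2) * x 1 = 0 by
      linear_combination s * h11 - t * h12)).resolve_left hq
    have e₃ : y 0 = 0 := (mul_eq_zero.1 (show (s ^ 2 + s * t + δ * t ^ 2) * y 0 = 0 by
      linear_combination (s + t * δ) * h21 + s * h22)).resolve_left hq
    have e₄ : y 1 = 0 := (mul_eq_zero.1 (show (s ^ 2 + s * t + δ * t ^ 2) * y 1 = 0 by
      linear_combination s * h21 - t * h22)).resolve_left hq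
    simp_all
  case regularDistinct => grind

theorem NormalForm.not_simpleRoot (δ γ : F) (i : NormalForm)
    (h : (Invariant.simpleRoot, false) ∈ i.values)
    (ha : i.Admissible δ γ) :
    ¬ Invariant.simpleRoot.holds (i.pencil δ γ) := by
  rintro ⟨s, t, hst, x, y, h1, h2, h3⟩
  cases i <;> first | (exfalso; revert h; decide) | skip
  case regularCubic =>
    have := Matrix.eq_zero_of_mulVec_eq_zero (det_regularCubic_ne_zero ha hst) h1
    simp [this] at h3
  case L₁L₁T =>
    replace h1 := fun j => congrFun h1 j
    replace h2 := fun j => congrFun h2 j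
    simp [NormalForm.pencil, Fin.forall_fin_succ, Matrix.vecMul, Matrix.mulVec, dotProduct,
      Fin.sum_univ_three] at h1 h2 h3
    grind

/-- The listed values of the invariants are correct. -/
theorem NormalForm.holds_iff_of_mem_values {δ γ : F} {i : NormalForm} (ha : i.Admissible δ γ)
    {p : Invariant × Bool} (hp : p ∈ i.values) : p.1.holds (i.pencil δ γ) ↔ p.2 = true := by
  obtain ⟨k, _ | _⟩ := p
  · simp only [Bool.false_eq_true, iff_false]
    cases k with
    | vanishes =>
      rintro ⟨h0, -⟩
      cases i <;> first | (exfalso; revert hp; decide) | exact one_ne_zero (congrFun (congrFun h0 0) 0)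
    | dependent => exact NormalForm.not_dependent δ γ i hp
    | rowDegenerate => exact NormalForm.not_rowDegenerate δ γ i hp
    | colDegenerate => exact NormalForm.not_colDegenerate δ γ i hp
    | allRankLeOne => exact NormalForm.not_allRankLeOne δ γ i hp
    | commonColumn =>
      rintro ⟨u, v, w, h1, h2⟩
      cases i <;> first | (exfalso; revert hp; decide) | skip
      have e₁ := congrFun (congrFun h1 0) 0
      have e₂ := congrFun (congrFun h1 1) 0
      have e₃ := congrFun (congrFun h2 1) 0
      simp [NormalForm.pencil, vecMulVec_apply] at e₁ e₂ e₃
      grind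
    | rankOneMember => exact NormalForm.not_rankOneMember δ γ i hp ha
    | twoRankOneMembers =>
      rintro ⟨s, t, s', t', hst, h1, h2⟩
      cases i <;> first | (exfalso; revert hp; decide) | skip
      have e₁ := h1.minor 0 0 1 1
      have e₂ := h2.minor 0 0 1 1
      simp [NormalForm.pencil] at e₁ e₂
      simp [e₁, e₂] at hst
    | multipleRoot => exact NormalForm.not_multipleRoot δ γ i hp ha
    | simpleRoot => exact NormalForm.not_simpleRoot δ γ i hp ha
    | twoSingularMembers => exact NormalForm.not_twoSingularMembers δ γ i hp ha
  · simp only [iff_true]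
    cases k with
    | vanishes => cases i <;> first | (exfalso; revert hp; decide) | exact ⟨rfl, rfl⟩
    | dependent =>
      refine ⟨0, 1, by simp, ?_⟩
      cases i <;> first | (exfalso; revert hp; decide) | simp [NormalForm.pencil]
    | rowDegenerate => exact NormalForm.rowDegenerate δ γ i hp
    | colDegenerate => exact NormalForm.colDegenerate δ γ i hp
    | allRankLeOne => exact NormalForm.allRankLeOne δ γ i hp
    | commonColumn =>
      refine ⟨![1, 0, 0], ![1, 0, 0], ![0, 1, 0], ?_⟩
      cases i <;> first | (exfalso; revert hp; decide) | skip
      constructor <;> ext j k <;> fin_cases j <;> fin_cases k <;>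
        simp [NormalForm.pencil, vecMulVec_apply]
    | rankOneMember => exact NormalForm.rankOneMember δ γ i hp
    | twoRankOneMembers =>
      refine ⟨1, 0, 0, 1, by simp, ?_⟩
      cases i <;> first | (exfalso; revert hp; decide) | skip
      constructor
      · refine ⟨![1, 0, 0], ![1, 0, 0], ?_⟩
        ext j k; fin_cases j <;> fin_cases k <;> simp [NormalForm.pencil, vecMulVec_apply]
      · refine ⟨![0, 1, 0], ![0, 1, 0], ?_⟩
        ext j k; fin_cases j <;> fin_cases k <;> simp [NormalForm.pencil, vecMulVec_apply]
    | multipleRoot => exact NormalForm.multipleRoot δ γ i hp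
    | simpleRoot => exact NormalForm.simpleRoot δ γ i hp
    | twoSingularMembers => exact NormalForm.twoSingularMembers δ γ i hp

/-- Distinct normal forms are inequivalent. -/
theorem NormalForm.eq_of_pencilEquiv {δ γ : F} {i j : NormalForm} (hi : i.Admissible δ γ)
    (hj : j.Admissible δ γ) (h : PencilEquiv (i.pencil δ γ) (j.pencil δ γ)) : i = j := by
  by_contra hij
  obtain ⟨p, hp, hp'⟩ := exists_values_ne i j hij
  have h1 := holds_iff_of_mem_values hi hp
  have h2 := holds_iff_of_mem_values hj hp'
  rw [← Invariant.holds_iff_of_pencilEquiv h, h1] at h2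
  cases hb : p.2 <;> simp [hb] at h2

/-! ### Reduction to the normal forms -/

/-- Every `3 × 3` matrix is equivalent to `diag(1, …, 1, 0, …, 0)`. -/
theorem exists_rank_normal_form (M : Matrix (Fin 3) (Fin 3) F) :
    ∃ P Q : Matrix (Fin 3) (Fin 3) F, P.det ≠ 0 ∧ Q.det ≠ 0 ∧
      P * M * Q ∈ ({0, !![1, 0, 0; 0, 0, 0; 0, 0, 0], !![1, 0, 0; 0, 1, 0; 0, 0, 0], 1} :
        Set (Matrix (Fin 3) (Fin 3) F)) := by
  obtain ⟨L, L', d, h⟩ := Matrix.Pivot.exists_list_transvec_mul_mul_list_transvec_eq_diagonal M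
  set P₀ := (L.map TransvectionStruct.toMatrix).prod
  set Q₀ := (L'.map TransvectionStruct.toMatrix).prod
  have hP₀ : P₀.det = 1 := TransvectionStruct.det_toMatrix_prod L
  have hQ₀ : Q₀.det = 1 := TransvectionStruct.det_toMatrix_prod L'
  have hd : P₀ * M * Q₀ = !![d 0, 0, 0; 0, d 1, 0; 0, 0, d 2] := by
    rw [h]
    ext i j; fin_cases i <;> fin_cases j <;> simp
  have key : ∀ P Q R : Matrix (Fin 3) (Fin 3) F, P.det ≠ 0 → Q.det ≠ 0 →
      R ∈ ({0, !![1, 0, 0; 0, 0, 0; 0, 0, 0], !![1, 0, 0; 0, 1, 0; 0, 0, 0], 1} :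
        Set (Matrix (Fin 3) (Fin 3) F)) →
      P * !![d 0, 0, 0; 0, d 1, 0; 0, 0, d 2] * Q = R →
      ∃ P Q : Matrix (Fin 3) (Fin 3) F, P.det ≠ 0 ∧ Q.det ≠ 0 ∧
        P * M * Q ∈ ({0, !![1, 0, 0; 0, 0, 0; 0, 0, 0], !![1, 0, 0; 0, 1, 0; 0, 0, 0], 1} :
          Set (Matrix (Fin 3) (Fin 3) F)) := by
    intro P Q R hP hQ hR hPQ
    refine ⟨P * P₀, Q₀ * Q, by simpa [hP₀] using hP, by simpa [hQ₀] using hQ, ?_⟩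
    rw [← hd] at hPQ
    rwa [show P * P₀ * M * (Q₀ * Q) = R by rw [← hPQ]; simp only [Matrix.mul_assoc]]
  -- scaling makes the diagonal entries `0` or `1`, and a permutation of coordinates sorts them
  by_cases h0 : d 0 = 0 <;> by_cases h1 : d 1 = 0 <;> by_cases h2 : d 2 = 0
  · refine key 1 1 0 (by simp) (by simp) (by simp) ?_
    ext i j; fin_cases i <;> fin_cases j <;> simp [h0, h1, h2]
  · refine key !![0, 0, (d 2)⁻¹; 0, 1, 0; 1, 0, 0] !![0, 0, 1; 0, 1, 0; 1, 0, 0] _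
      (by simp [Matrix.det_fin_three, h2]) (by simp [Matrix.det_fin_three]) (Or.inr (Or.inl rfl)) ?_
    ext i j; fin_cases i <;> fin_cases j <;> simp [h0, h1, h2]
  · refine key !![0, (d 1)⁻¹, 0; 1, 0, 0; 0, 0, 1] !![0, 1, 0; 1, 0, 0; 0, 0, 1] _
      (by simp [Matrix.det_fin_three, h1]) (by simp [Matrix.det_fin_three]) (Or.inr (Or.inl rfl)) ?_
    ext i j; fin_cases i <;> fin_cases j <;> simp [h0, h1, h2]
  · refine key !![0, (d 1)⁻¹, 0; 0, 0, (d 2)⁻¹; 1, 0, 0] !![0, 0, 1; 1, 0, 0; 0, 1, 0] _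
      (by simp [Matrix.det_fin_three, h1, h2]) (by simp [Matrix.det_fin_three])
      (Or.inr (Or.inr (Or.inl rfl))) ?_
    ext i j; fin_cases i <;> fin_cases j <;> simp [h0, h1, h2]
  · refine key !![(d 0)⁻¹, 0, 0; 0, 1, 0; 0, 0, 1] 1 _
      (by simp [Matrix.det_fin_three, h0]) (by simp) (Or.inr (Or.inl rfl)) ?_
    ext i j; fin_cases i <;> fin_cases j <;> simp [h0, h1, h2]
  · refine key !![(d 0)⁻¹, 0, 0; 0, 0, (d 2)⁻¹; 0, 1, 0] !![1, 0, 0; 0, 0, 1; 0, 1, 0] _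
      (by simp [Matrix.det_fin_three, h0, h2]) (by simp [Matrix.det_fin_three])
      (Or.inr (Or.inr (Or.inl rfl))) ?_
    ext i j; fin_cases i <;> fin_cases j <;> simp [h0, h1, h2]
  · refine key !![(d 0)⁻¹, 0, 0; 0, (d 1)⁻¹, 0; 0, 0, 1] 1 _
      (by simp [Matrix.det_fin_three, h0, h1]) (by simp) (Or.inr (Or.inr (Or.inl rfl))) ?_
    ext i j; fin_cases i <;> fin_cases j <;> simp [h0, h1, h2]
  · refine key !![(d 0)⁻¹, 0, 0; 0, (d 1)⁻¹, 0; 0, 0, (d 2)⁻¹] 1 _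
      (by simp [Matrix.det_fin_three, h0, h1, h2]) (by simp) (Or.inr (Or.inr (Or.inr rfl))) ?_
    ext i j; fin_cases i <;> fin_cases j <;> simp [h0, h1, h2]

/-! ### Similarity of `2 × 2` matrices -/

/-- A `2 × 2` matrix that is not scalar is similar to the companion matrix of its characteristic
polynomial. -/
theorem exists_similar_companion (C : Matrix (Fin 2) (Fin 2) F)
    (h : ¬ (C 0 1 = 0 ∧ C 1 0 = 0 ∧ C 0 0 = C 1 1)) :
    ∃ P : Matrix (Fin 2) (Fin 2) F, P.det ≠ 0 ∧ C * P = P * !![0, -C.det; 1, C.trace] := by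
  -- the columns of `P` are `v` and `C v` for a vector `v` that is no eigenvector
  have key : ∀ x y : F, x * (C 1 0 * x + C 1 1 * y) - (C 0 0 * x + C 0 1 * y) * y ≠ 0 →
      ∃ P : Matrix (Fin 2) (Fin 2) F, P.det ≠ 0 ∧ C * P = P * !![0, -C.det; 1, C.trace] := by
    intro x y hxy
    refine ⟨!![x, C 0 0 * x + C 0 1 * y; y, C 1 0 * x + C 1 1 * y],
      by simpa [Matrix.det_fin_two] using hxy, ?_⟩
    ext i j
    fin_cases i <;> fin_cases j <;>
      simp [Matrix.mul_apply, Fin.sum_univ_two, Matrix.det_fin_two, Matrix.trace_fin_two] <;> ring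
  by_cases h1 : C 1 0 = 0
  · by_cases h2 : C 0 1 = 0
    · refine key 1 1 ?_
      rw [h1, h2]
      intro h0
      exact h ⟨h2, h1, by linear_combination -h0⟩
    · exact key 0 1 (by simpa using h2)
  · exact key 1 0 (by simpa using h1)

/-- Similarity classes of `2 × 2` matrices. -/
theorem exists_similar (C : Matrix (Fin 2) (Fin 2) F) :
    ∃ P C' : Matrix (Fin 2) (Fin 2) F, P.det ≠ 0 ∧ C * P = P * C' ∧
      ((∃ c, C' = !![c, 0; 0, c]) ∨ (∃ a b, a ≠ b ∧ C' = !![a, 0; 0, b]) ∨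
        (∃ a, C' = !![a, 1; 0, a]) ∨
        ∃ τ d, (∀ x : F, x ^ 2 - τ * x + d ≠ 0) ∧ C' = !![0, -d; 1, τ]) := by
  by_cases h : C 0 1 = 0 ∧ C 1 0 = 0 ∧ C 0 0 = C 1 1
  · refine ⟨1, C, by simp, by simp, Or.inl ⟨C 0 0, ?_⟩⟩
    ext i j
    fin_cases i <;> fin_cases j <;> simp [h]
  obtain ⟨P, hP, hC⟩ := exists_similar_companion C h
  by_cases hroot : ∀ x : F, x ^ 2 - C.trace * x + C.det ≠ 0
  · exact ⟨P, _, hP, hC, Or.inr (Or.inr (Or.inr ⟨_, _, hroot, rfl⟩))⟩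
  push Not at hroot
  obtain ⟨a, ha⟩ := hroot
  obtain ⟨b, hb⟩ : ∃ b, C.trace = a + b := ⟨C.trace - a, by ring⟩
  have hdet : C.det = a * b := by rw [hb] at ha; linear_combination ha
  rw [hb, hdet] at hC
  have lift : ∀ R C' : Matrix (Fin 2) (Fin 2) F, R.det ≠ 0 →
      !![0, -(a * b); 1, a + b] * R = R * C' → (P * R).det ≠ 0 ∧ C * (P * R) = P * R * C' := by
    intro R C' hR h
    refine ⟨by simp [hP, hR], ?_⟩
    rw [← Matrix.mul_assoc, hC, Matrix.mul_assoc, h, Matrix.mul_assoc]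
  by_cases hab : a = b
  · subst hab
    obtain ⟨h1, h2⟩ := lift !![-a, 1; 1, 0] !![a, 1; 0, a] (by simp [Matrix.det_fin_two])
      (by ext i j; fin_cases i <;> fin_cases j <;> simp)
    exact ⟨_, _, h1, h2, Or.inr (Or.inr (Or.inl ⟨a, rfl⟩))⟩
  · obtain ⟨h1, h2⟩ := lift !![-b, -a; 1, 1] !![a, 0; 0, b]
      (by
        simp only [Matrix.det_fin_two_of]
        intro h0
        exact hab (by linear_combination h0))
      (by ext i j; fin_cases i <;> fin_cases j <;> simp; ring)
    exact ⟨_, _, h1, h2, Or.inr (Or.inl ⟨a, b, hab, rfl⟩)⟩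

/-! ### Pencils with a member of rank two -/

/-- The matrix with blocks `C`, `u`, `v`, `w`. -/
def bordered (C : Matrix (Fin 2) (Fin 2) F) (u v : Fin 2 → F) (w : F) :
    Matrix (Fin 3) (Fin 3) F :=
  !![C 0 0, C 0 1, u 0; C 1 0, C 1 1, u 1; v 0, v 1, w]

/-- A similarity `C ∼ C'` acts on the border of `C`, and leaves `diag(1, 1, 0)` alone. -/
theorem bordered_conj (C C' P : Matrix (Fin 2) (Fin 2) F) (hP : P.det ≠ 0) (h : C * P = P * C')
    (u' v : Fin 2 → F) (w : F) :
    PencilEquiv (!![1, 0, 0; 0, 1, 0; 0, 0, 0], bordered C (P *ᵥ u') v w)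
      (!![1, 0, 0; 0, 1, 0; 0, 0, 0], bordered C' u' (v ᵥ* P) w) := by
  refine (PencilEquiv.of_mul_eq (bordered P 0 0 1) (bordered P 0 0 1) 1 0 0 1 ?_ ?_ (by simp)
    ?_ ?_).symm
  · simpa [bordered, Matrix.det_fin_three, Matrix.det_fin_two] using hP
  · simpa [bordered, Matrix.det_fin_three, Matrix.det_fin_two] using hP
  · simp [bordered]
  · have h' := fun i j => congrFun (congrFun h i) j
    simp only [Matrix.mul_apply, Fin.sum_univ_two, Fin.forall_fin_two] at h'
    obtain ⟨⟨e₁, e₂⟩, e₃, e₄⟩ := h'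
    simp [bordered, Matrix.mulVec, Matrix.vecMul, dotProduct, e₁, e₂, e₃, e₄]

/-- A nonzero corner serves as a pivot that clears the border. -/
theorem bordered_clear (C : Matrix (Fin 2) (Fin 2) F) (u v : Fin 2 → F) {w : F} (hw : w ≠ 0) :
    ∃ C', PencilEquiv (!![1, 0, 0; 0, 1, 0; 0, 0, 0], bordered C u v w)
      (!![1, 0, 0; 0, 1, 0; 0, 0, 0], bordered C' 0 0 1) := by
  refine ⟨!![C 0 0 - u 0 * v 0 / w, C 0 1 - u 0 * v 1 / w;
      C 1 0 - u 1 * v 0 / w, C 1 1 - u 1 * v 1 / w],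
    PencilEquiv.of_mul_eq !![1, 0, -u 0 / w; 0, 1, -u 1 / w; 0, 0, 1] !![1, 0, 0; 0, 1, 0; v 0, v 1, w]
      1 0 0 1 ?_ ?_ (by simp) ?_ ?_⟩
  · simp [Matrix.det_fin_three]
  · simpa [Matrix.det_fin_three] using hw
  · simp
  · ext i j
    fin_cases i <;> fin_cases j <;> simp [bordered] <;> field_simp <;> ring

/-- The normal form `(diag(1, 1, 0), N ⊕ e)` behind the two quadratic types, for `N` with trace and
determinant those of `l + m D`, where `D` is the companion matrix of `x² - x + δ`. -/
theorem bordered_quadratic (δ γ : F) {C : Matrix (Fin 2) (Fin 2) F}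
    (hC : ∀ x : F, x ^ 2 - C.trace * x + C.det ≠ 0) {l m : F} (hm : m ≠ 0)
    (htr : C.trace = 2 * l + m) (hdet : C.det = l ^ 2 + l * m + m ^ 2 * δ) :
    PencilEquiv (!![1, 0, 0; 0, 1, 0; 0, 0, 0], bordered C 0 0 0)
      (NormalForm.squareQuadratic.pencil δ γ) ∧
    PencilEquiv (!![1, 0, 0; 0, 1, 0; 0, 0, 0], bordered C 0 0 1)
      (NormalForm.regularQuadratic.pencil δ γ) := by
  -- `C` and `l + m D` are not scalar, hence similar to the same companion matrix
  set N : Matrix (Fin 2) (Fin 2) F := !![l + m, -(m * δ); m, l] with hN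
  have hNtr : N.trace = C.trace := by simp [hN, Matrix.trace_fin_two, htr]; ring
  have hNdet : N.det = C.det := by simp [hN, Matrix.det_fin_two, hdet]; ring
  obtain ⟨P, hP, hP'⟩ := exists_similar_companion C (by
    rintro ⟨h1, h2, h3⟩
    refine hC (C 0 0) ?_
    rw [Matrix.trace_fin_two, Matrix.det_fin_two, h1, ← h3]
    ring)
  obtain ⟨R, hR, hR'⟩ := exists_similar_companion N (by simp [hN, hm])
  rw [hNtr, hNdet] at hR'
  have sim : ∀ e : F, PencilEquiv (!![1, 0, 0; 0, 1, 0; 0, 0, 0], bordered C 0 0 e)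
      (!![1, 0, 0; 0, 1, 0; 0, 0, 0], bordered N 0 0 e) := fun e => by
    have h1 := bordered_conj C _ P hP hP' 0 0 e
    have h2 := bordered_conj N _ R hR hR' 0 0 e
    rw [Matrix.mulVec_zero, Matrix.zero_vecMul] at h1 h2
    exact h1.trans h2.symm
  constructor
  · refine (sim 0).trans (PencilEquiv.of_mul_eq !![0, 1, 0; 1, -1, 0; 0, 0, m] 1 1 0 (-l / m) m⁻¹
      ?_ (by simp) (by simpa using hm) ?_ ?_)
    · simpa [Matrix.det_fin_three] using hm
    · ext i j
      fin_cases i <;> fin_cases j <;> simp [NormalForm.pencil]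
    · ext i j
      fin_cases i <;> fin_cases j <;> simp [NormalForm.pencil, bordered, hN] <;> field_simp <;> ring
  · refine (sim 1).trans (PencilEquiv.of_mul_eq !![0, 1, 0; 1, -1, 0; 0, 0, m] 1 1 0 (-l / m) m⁻¹
      ?_ (by simp) (by simpa using hm) ?_ ?_)
    · simpa [Matrix.det_fin_three] using hm
    · ext i j
      fin_cases i <;> fin_cases j <;> simp [NormalForm.pencil]
    · ext i j
      fin_cases i <;> fin_cases j <;> simp [NormalForm.pencil, bordered, hN] <;> field_simp <;> ring

/-- What the arithmetic of `F` has to supply to bring every pencil to a normal form in `S`: all types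
whose determinant splits are in `S`; if there are rootless quadratics `x² - τ x + d`, then the
quadratic types are in `S`, and every such quadratic becomes proportional to `x² - x + δ` under an
affine substitution `x ↦ m x + l`; if there are rootless cubics, then the cubic type is in `S`, and
their companion matrices give pencils equivalent to it. -/
structure NormalizesRootless (S : Finset NormalForm) (δ γ : F) : Prop where
  split : ∀ i, i ≠ .squareQuadratic → i ≠ .regularQuadratic → i ≠ .regularCubic → i ∈ S
  quadratic : ∀ τ d : F, (∀ x : F, x ^ 2 - τ * x + d ≠ 0) →
    NormalForm.squareQuadratic ∈ S ∧ NormalForm.regularQuadratic ∈ S ∧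
      ∃ l m : F, m ≠ 0 ∧ τ = 2 * l + m ∧ d = l ^ 2 + l * m + m ^ 2 * δ
  cubic : ∀ a b c : F, (∀ x : F, x ^ 3 - a * x ^ 2 - b * x - c ≠ 0) →
    NormalForm.regularCubic ∈ S ∧ PencilEquiv ((1, !![0, 0, c; 1, 0, b; 0, 1, a]) : Pencil F)
      (NormalForm.regularCubic.pencil δ γ)

/-- The pencil is equivalent to a normal form in `S`. -/
def HasNormalForm (S : Finset NormalForm) (δ γ : F) (X : Pencil F) : Prop :=
  ∃ i ∈ S, PencilEquiv X (i.pencil δ γ)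

variable {S : Finset NormalForm} {δ γ : F} {X Y : Pencil F}

theorem HasNormalForm.of_pencilEquiv (h : PencilEquiv X Y) (hY : HasNormalForm S δ γ Y) :
    HasNormalForm S δ γ X := by
  obtain ⟨i, hi, hYi⟩ := hY
  exact ⟨i, hi, h.trans hYi⟩

theorem NormalizesRootless.transpose_mem (hS : NormalizesRootless S δ γ) {i : NormalForm}
    (hi : i ∈ S) : i.transpose ∈ S := by
  cases i <;> first | exact hi | exact hS.split _ (by decide) (by decide) (by decide)

theorem HasNormalForm.of_transpose (hS : NormalizesRootless S δ γ)
    (h : HasNormalForm S δ γ (X.1ᵀ, X.2ᵀ)) : HasNormalForm S δ γ X := by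
  obtain ⟨i, hi, hXi⟩ := h
  refine ⟨i.transpose, hS.transpose_mem hi, ?_⟩
  rw [NormalForm.pencil_transpose]
  simpa using hXi.transpose

theorem NormalizesRootless.hasNormalForm (hS : NormalizesRootless S δ γ) (i : NormalForm)
    (h : PencilEquiv X (i.pencil δ γ)) (h1 : i ≠ .squareQuadratic := by decide)
    (h2 : i ≠ .regularQuadratic := by decide) (h3 : i ≠ .regularCubic := by decide) :
    HasNormalForm S δ γ X :=
  ⟨i, hS.split i h1 h2 h3, h⟩

/-- Without a border, the similarity class of `C` decides. A root of its characteristic polynomial is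
moved to zero by subtracting a multiple of the first slice. -/
theorem hasNormalForm_bordered_zero (hS : NormalizesRootless S δ γ) (C : Matrix (Fin 2) (Fin 2) F) :
    HasNormalForm S δ γ (!![1, 0, 0; 0, 1, 0; 0, 0, 0], bordered C 0 0 0) ∧
    HasNormalForm S δ γ (!![1, 0, 0; 0, 1, 0; 0, 0, 0], bordered C 0 0 1) := by
  obtain ⟨P, C', hP, hC, hC'⟩ := exists_similar C
  have sim : ∀ e : F, PencilEquiv (!![1, 0, 0; 0, 1, 0; 0, 0, 0], bordered C 0 0 e)
      (!![1, 0, 0; 0, 1, 0; 0, 0, 0], bordered C' 0 0 e) := fun e => by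
    have h1 := bordered_conj C _ P hP hC 0 0 e
    rwa [Matrix.mulVec_zero, Matrix.zero_vecMul] at h1
  suffices H : HasNormalForm S δ γ (!![1, 0, 0; 0, 1, 0; 0, 0, 0], bordered C' 0 0 0) ∧
      HasNormalForm S δ γ (!![1, 0, 0; 0, 1, 0; 0, 0, 0], bordered C' 0 0 1) from
    ⟨H.1.of_pencilEquiv (sim 0), H.2.of_pencilEquiv (sim 1)⟩
  rcases hC' with ⟨c, rfl⟩ | ⟨a, b, hab, rfl⟩ | ⟨a, rfl⟩ | ⟨τ, d, hroot, rfl⟩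
  · refine ⟨hS.hasNormalForm .rankTwo (PencilEquiv.of_mul_eq 1 1 1 0 (-c) 1 (by simp) (by simp)
      (by simp) ?_ ?_), hS.hasNormalForm .regularDoubleSplit
        (PencilEquiv.of_mul_eq 1 1 1 0 (-c) 1 (by simp) (by simp) (by simp) ?_ ?_)⟩ <;>
      ext i j <;> fin_cases i <;> fin_cases j <;> simp [NormalForm.pencil, bordered]
  · have h1 : a - b ≠ 0 := sub_ne_zero.2 hab
    have h2 : b - a ≠ 0 := sub_ne_zero.2 hab.symm
    refine ⟨hS.hasNormalForm .squareDistinct (PencilEquiv.of_mul_eq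
        !![(a - b)⁻¹, 0, 0; 0, (b - a)⁻¹, 0; 0, 0, 1] 1 (-b) 1 (-a) 1 ?_ (by simp) ?_ ?_ ?_),
      hS.hasNormalForm .regularDistinct (PencilEquiv.of_mul_eq
        !![(a - b)⁻¹, 0, 0; 0, (b - a)⁻¹, 0; 0, 0, 1] 1 (-b) 1 (-a) 1 ?_ (by simp) ?_ ?_ ?_)⟩
    · simp [Matrix.det_fin_three, h1, h2]
    · intro h; exact h1 (by linear_combination h)
    · ext i j; fin_cases i <;> fin_cases j <;> simp [NormalForm.pencil, bordered]; field_simp; ring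
    · ext i j; fin_cases i <;> fin_cases j <;> simp [NormalForm.pencil, bordered]; field_simp; ring
    · simp [Matrix.det_fin_three, h1, h2]
    · intro h; exact h1 (by linear_combination h)
    · ext i j; fin_cases i <;> fin_cases j <;> simp [NormalForm.pencil, bordered]; field_simp; ring
    · ext i j; fin_cases i <;> fin_cases j <;> simp [NormalForm.pencil, bordered]; field_simp; ring
  · refine ⟨hS.hasNormalForm .squareDouble (PencilEquiv.of_mul_eq !![0, 1, 0; 1, 0, 0; 0, 0, 1] 1
        1 0 (-a) 1 ?_ (by simp) (by simp) ?_ ?_), hS.hasNormalForm .regularDouble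
        (PencilEquiv.of_mul_eq !![0, 1, 0; 1, 0, 0; 0, 0, 1] 1 1 0 (-a) 1 ?_ (by simp) (by simp)
        ?_ ?_)⟩
    · simp [Matrix.det_fin_three]
    · ext i j; fin_cases i <;> fin_cases j <;> simp [NormalForm.pencil]
    · ext i j; fin_cases i <;> fin_cases j <;> simp [NormalForm.pencil, bordered]
    · simp [Matrix.det_fin_three]
    · ext i j; fin_cases i <;> fin_cases j <;> simp [NormalForm.pencil]
    · ext i j; fin_cases i <;> fin_cases j <;> simp [NormalForm.pencil, bordered]
  · obtain ⟨hs, hr, l, m, hm, hτ, hd⟩ := hS.quadratic τ d hroot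
    have htr : (!![0, -d; 1, τ]).trace = τ := by simp [Matrix.trace_fin_two]
    have hdet : (!![0, -d; 1, τ]).det = d := by simp [Matrix.det_fin_two]
    have := bordered_quadratic δ γ (C := !![0, -d; 1, τ]) (by rwa [htr, hdet]) hm (by rw [htr, hτ])
      (by rw [hdet, hd])
    exact ⟨⟨_, hs, this.1⟩, ⟨_, hr, this.2⟩⟩

theorem hasNormalForm_bordered_col (hS : NormalizesRootless S δ γ) (C : Matrix (Fin 2) (Fin 2) F)
    {u : Fin 2 → F} (hu : u ≠ 0) :
    HasNormalForm S δ γ (!![1, 0, 0; 0, 1, 0; 0, 0, 0], bordered C u 0 0) := by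
  obtain ⟨P, hP, rfl⟩ : ∃ P : Matrix (Fin 2) (Fin 2) F, P.det ≠ 0 ∧ P *ᵥ ![1, 0] = u := by
    by_cases h0 : u 0 = 0
    · have h1 : u 1 ≠ 0 := fun h1 => hu (by ext i; fin_cases i <;> simp [h0, h1])
      refine ⟨!![0, 1; u 1, 0], by simpa [Matrix.det_fin_two] using h1, ?_⟩
      ext i; fin_cases i <;> simp [h0]
    · refine ⟨!![u 0, 0; u 1, 1], by simpa [Matrix.det_fin_two] using h0, ?_⟩
      ext i; fin_cases i <;> simp
  have hC : C * P = P * (P⁻¹ * C * P) := by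
    rw [Matrix.mul_assoc, Matrix.mul_nonsing_inv_cancel_left _ _ (isUnit_iff_ne_zero.2 hP)]
  refine HasNormalForm.of_pencilEquiv (bordered_conj C _ P hP hC _ _ _) ?_
  generalize P⁻¹ * C * P = C'
  rw [Matrix.zero_vecMul]
  by_cases hr : C' 1 0 = 0
  · refine hS.hasNormalForm .L₁J₁ (PencilEquiv.of_mul_eq 1
      !![1, 0, 0; C' 0 0 - C' 1 1, C' 0 1, 1; 0, 1, 0] 1 0 (-C' 1 1) 1 (by simp) ?_ (by simp) ?_ ?_)
    · simp [Matrix.det_fin_three]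
    · ext i j; fin_cases i <;> fin_cases j <;> simp [NormalForm.pencil]
    · ext i j; fin_cases i <;> fin_cases j <;> simp [NormalForm.pencil, bordered, hr]; ring
  · refine hS.hasNormalForm .L₂ (PencilEquiv.of_mul_eq !![0, 1, 0; 1, 0, 0; 0, 0, 1]
      !![0, C' 1 0, 0; C' 1 0, 0, 0; C' 0 0 - C' 1 1, C' 0 1, 1] (C' 1 0) 0 (-C' 1 1) 1 ?_ ?_
      (by simpa using hr) ?_ ?_)
    · simp [Matrix.det_fin_three]
    · simpa [Matrix.det_fin_three] using hr
    · ext i j; fin_cases i <;> fin_cases j <;> simp [NormalForm.pencil]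
    · ext i j; fin_cases i <;> fin_cases j <;> simp [NormalForm.pencil, bordered]; ring

theorem hasNormalForm_bordered_col_row (hS : NormalizesRootless S δ γ)
    (C : Matrix (Fin 2) (Fin 2) F) {u v : Fin 2 → F} (hu : u ≠ 0) (hv : v ≠ 0) :
    HasNormalForm S δ γ (!![1, 0, 0; 0, 1, 0; 0, 0, 0], bordered C u v 0) := by
  by_cases hk : v 0 * u 0 + v 1 * u 1 = 0
  · -- a basis change makes `u` and `v` the standard vectors `e₀` and `e₁`
    obtain ⟨z, hz⟩ : ∃ z : Fin 2 → F, v 0 * z 0 + v 1 * z 1 = 1 := by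
      by_cases h0 : v 0 = 0
      · have h1 : v 1 ≠ 0 := fun h1 => hv (by ext i; fin_cases i <;> simp [h0, h1])
        exact ⟨![0, (v 1)⁻¹], by simp [h1]⟩
      · exact ⟨![(v 0)⁻¹, 0], by simp [h0]⟩
    set P : Matrix (Fin 2) (Fin 2) F := !![u 0, z 0; u 1, z 1] with hPdef
    have hP : P.det ≠ 0 := by
      rw [hPdef, Matrix.det_fin_two_of]
      intro h0
      refine hu ?_
      ext i; fin_cases i
      · simp; linear_combination -u 0 * hz + z 0 * hk + v 1 * h0
      · simp; linear_combination -u 1 * hz + z 1 * hk - v 0 * h0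
    have hPu : P *ᵥ ![1, 0] = u := by ext i; fin_cases i <;> simp [hPdef]
    have hvP : v ᵥ* P = ![0, 1] := by
      ext i; fin_cases i
      · simpa [hPdef, Matrix.vecMul, dotProduct] using hk
      · simpa [hPdef, Matrix.vecMul, dotProduct] using hz
    have hC : C * P = P * (P⁻¹ * C * P) := by
      rw [Matrix.mul_assoc, Matrix.mul_nonsing_inv_cancel_left _ _ (isUnit_iff_ne_zero.2 hP)]
    have := bordered_conj C _ P hP hC ![1, 0] v 0
    rw [hPu, hvP] at this
    refine HasNormalForm.of_pencilEquiv this ?_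
    generalize P⁻¹ * C * P = C'
    by_cases hr : C' 1 0 = 0
    · refine hS.hasNormalForm .L₁L₁T (PencilEquiv.of_mul_eq !![0, 1, -C' 1 1; 0, 0, 1; 1, 0, 0]
        !![1, 0, 0; C' 0 0, C' 0 1, 1; 0, 1, 0] 1 0 0 1 ?_ ?_ (by simp) ?_ ?_)
      · simp [Matrix.det_fin_three]
      · simp [Matrix.det_fin_three]
      · ext i j; fin_cases i <;> fin_cases j <;> simp [NormalForm.pencil]
      · ext i j; fin_cases i <;> fin_cases j <;> simp [NormalForm.pencil, bordered, hr]
    · refine hS.hasNormalForm .regularTriple (PencilEquiv.of_mul_eq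
        !![0, 0, 1; 0, 1, -C' 1 1; C' 1 0, 0, 0]
        !![C' 1 0 * C' 0 0, C' 1 0 * C' 0 1, C' 1 0; C' 1 0, 0, 0; 0, 1, 0] 0 1 1 0 ?_ ?_ (by simp)
        ?_ ?_)
      · simpa [Matrix.det_fin_three] using hr
      · simpa [Matrix.det_fin_three] using hr
      · ext i j; fin_cases i <;> fin_cases j <;> simp [NormalForm.pencil, bordered]
      · ext i j; fin_cases i <;> fin_cases j <;> simp [NormalForm.pencil]
  · -- a basis change makes `u = e₀` and `v` a multiple of `e₀`
    set k := v 0 * u 0 + v 1 * u 1 with hkdef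
    set P : Matrix (Fin 2) (Fin 2) F := !![u 0, -v 1; u 1, v 0] with hPdef
    have hP : P.det ≠ 0 := by
      rw [hPdef, Matrix.det_fin_two_of]
      intro h0
      exact hk (by rw [hkdef]; linear_combination h0)
    have hPu : P *ᵥ ![1, 0] = u := by ext i; fin_cases i <;> simp [hPdef]
    have hvP : v ᵥ* P = ![k, 0] := by
      ext i; fin_cases i
      · simp [hPdef, Matrix.vecMul, dotProduct, hkdef]
      · simp [hPdef, Matrix.vecMul, dotProduct]; ring
    have hC : C * P = P * (P⁻¹ * C * P) := by
      rw [Matrix.mul_assoc, Matrix.mul_nonsing_inv_cancel_left _ _ (isUnit_iff_ne_zero.2 hP)]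
    have := bordered_conj C _ P hP hC ![1, 0] v 0
    rw [hPu, hvP] at this
    refine HasNormalForm.of_pencilEquiv this ?_
    generalize P⁻¹ * C * P = C'
    refine hS.hasNormalForm .regularDouble (PencilEquiv.of_mul_eq
      !![0, 0, k⁻¹; 1, 0, 0; 0, 1, -C' 1 0 / k]
      !![C' 0 0 - C' 1 1, C' 0 1, 1; 1, 0, 0; 0, 1, 0] (-C' 1 1) 1 1 0 ?_ ?_ (by simp) ?_ ?_)
    · simp [Matrix.det_fin_three, hk]
    · simp [Matrix.det_fin_three]
    · ext i j; fin_cases i <;> fin_cases j <;> simp [NormalForm.pencil, bordered] <;> field_simp <;> ring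
    · ext i j; fin_cases i <;> fin_cases j <;> simp [NormalForm.pencil]

/-- Pencils whose first slice has rank two. -/
theorem hasNormalForm_of_rank_two (hS : NormalizesRootless S δ γ) (B : Matrix (Fin 3) (Fin 3) F) :
    HasNormalForm S δ γ (!![1, 0, 0; 0, 1, 0; 0, 0, 0], B) := by
  obtain ⟨C, u, v, w, rfl⟩ : ∃ C u v w, B = bordered C u v w := by
    refine ⟨!![B 0 0, B 0 1; B 1 0, B 1 1], ![B 0 2, B 1 2], ![B 2 0, B 2 1], B 2 2, ?_⟩
    ext i j; fin_cases i <;> fin_cases j <;> rfl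
  by_cases hw : w = 0
  · subst hw
    by_cases hu : u = 0 <;> by_cases hv : v = 0
    · subst hu hv
      exact (hasNormalForm_bordered_zero hS C).1
    · subst hu
      refine HasNormalForm.of_transpose hS ?_
      have := hasNormalForm_bordered_col hS Cᵀ hv
      convert this using 2
      · ext i j; fin_cases i <;> fin_cases j <;> rfl
      · ext i j; fin_cases i <;> fin_cases j <;> rfl
    · subst hv
      exact hasNormalForm_bordered_col hS C hu
    · exact hasNormalForm_bordered_col_row hS C hu hv
  · obtain ⟨C', h⟩ := bordered_clear C u v hw
    exact (hasNormalForm_bordered_zero hS C').2.of_pencilEquiv h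

end
section
variable {F : Type*} [Field F] {S : Finset NormalForm} {δ γ : F} {X Y : Pencil F}

/-! ### Pencils with a member of rank one -/

/-- A pencil whose first slice is `E₀₀` and whose second slice has a nonzero entry `(1, 1)`. -/
theorem hasNormalForm_of_rank_one_of_pivot (hS : NormalizesRootless S δ γ)
    {B : Matrix (Fin 3) (Fin 3) F} (hk : B 1 1 ≠ 0) :
    HasNormalForm S δ γ (!![1, 0, 0; 0, 0, 0; 0, 0, 0], B) := by
  -- elimination with the pivot `B 1 1`
  obtain ⟨x, y, w, h⟩ : ∃ x y w, PencilEquiv (!![1, 0, 0; 0, 0, 0; 0, 0, 0], B)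
      (!![1, 0, 0; 0, 0, 0; 0, 0, 0], !![0, 0, y; 0, 1, 0; x, 0, w]) := by
    refine ⟨B 2 0 - B 2 1 / B 1 1 * B 1 0, B 0 2 - B 0 1 / B 1 1 * B 1 2,
      B 2 2 - B 2 1 / B 1 1 * B 1 2, PencilEquiv.of_mul_eq
        !![1, -(B 0 1 / B 1 1), 0; 0, (B 1 1)⁻¹, 0; 0, -(B 2 1 / B 1 1), 1]
        !![1, 0, 0; B 1 0 / B 1 1, 1, B 1 2 / B 1 1; 0, 0, 1]
        1 0 (-(B 0 0 - B 0 1 / B 1 1 * B 1 0)) 1 ?_ ?_ (by simp) ?_ ?_⟩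
    · simp [Matrix.det_fin_three, hk]
    · simp [Matrix.det_fin_three]
    · ext i j; fin_cases i <;> fin_cases j <;> simp
    · rw [Matrix.eta_fin_three B]
      ext i j; fin_cases i <;> fin_cases j <;> simp <;> field_simp <;> ring
  refine HasNormalForm.of_pencilEquiv h ?_
  have col : ∀ {y : F}, y ≠ 0 → HasNormalForm S δ γ
      (!![1, 0, 0; 0, 0, 0; 0, 0, 0], !![0, 0, 0; 0, 1, 0; y, 0, 0]) := fun {y} hy => by
    refine hS.hasNormalForm .L₁J₁T (PencilEquiv.of_mul_eq !![0, 0, y⁻¹; 1, 0, 0; 0, 1, 0] 1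
      0 1 1 0 ?_ (by simp) (by simp) ?_ ?_)
    · simp [Matrix.det_fin_three, hy]
    · ext i j; fin_cases i <;> fin_cases j <;> simp [NormalForm.pencil, hy]
    · ext i j; fin_cases i <;> fin_cases j <;> simp [NormalForm.pencil]
  by_cases hw : w = 0
  · subst hw
    by_cases hx : x = 0 <;> by_cases hy : y = 0
    · subst hx hy
      exact hS.hasNormalForm .squareDistinct (PencilEquiv.refl _)
    · subst hx
      refine HasNormalForm.of_transpose hS ?_
      convert col hy using 2
      · ext i j; fin_cases i <;> fin_cases j <;> rfl
      · ext i j; fin_cases i <;> fin_cases j <;> rfl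
    · subst hy
      exact col hx
    · refine hS.hasNormalForm .regularTripleSplit (PencilEquiv.of_mul_eq
        !![0, 0, x⁻¹; 1, 0, 0; 0, 1, 0] !![0, 0, y; 1, 0, 0; 0, 1, 0] 0 1 1 0 ?_ ?_ (by simp) ?_ ?_)
      · simp [Matrix.det_fin_three, hx]
      · simp [Matrix.det_fin_three, hy]
      · ext i j; fin_cases i <;> fin_cases j <;> simp [NormalForm.pencil, hx]
      · ext i j; fin_cases i <;> fin_cases j <;> simp [NormalForm.pencil]
  · refine hS.hasNormalForm .regularDoubleSplit (PencilEquiv.of_mul_eq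
      !![0, 1, 0; 0, 0, 1; 1, 0, -(y / w)] !![0, 1, 0; x, 0, w; 1, 0, 0] (x * y / w) 1 1 0
      ?_ ?_ (by simp) ?_ ?_)
    · simp [Matrix.det_fin_three]
    · simp [Matrix.det_fin_three, hw]
    · ext i j; fin_cases i <;> fin_cases j <;> simp [NormalForm.pencil] <;> field_simp <;> ring
    · ext i j; fin_cases i <;> fin_cases j <;> simp [NormalForm.pencil]

/-- Exchanging the last two rows, or the last two columns, of the second slice. -/
theorem pencilEquiv_swap (B : Matrix (Fin 3) (Fin 3) F) :
    PencilEquiv (!![1, 0, 0; 0, 0, 0; 0, 0, 0], B)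
      (!![1, 0, 0; 0, 0, 0; 0, 0, 0], B.submatrix (Equiv.swap 1 2) id) ∧
    PencilEquiv (!![1, 0, 0; 0, 0, 0; 0, 0, 0], B)
      (!![1, 0, 0; 0, 0, 0; 0, 0, 0], B.submatrix id (Equiv.swap 1 2)) := by
  have h1 : (Equiv.swap 1 2 : Equiv.Perm (Fin 3)) 0 = 0 := by decide
  have h2 : (Equiv.swap 1 2 : Equiv.Perm (Fin 3)) 1 = 2 := by decide
  have h3 : (Equiv.swap 1 2 : Equiv.Perm (Fin 3)) 2 = 1 := by decide
  constructor
  · refine PencilEquiv.of_mul_eq !![1, 0, 0; 0, 0, 1; 0, 1, 0] 1 1 0 0 1 ?_ (by simp) (by simp) ?_ ?_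
    · simp [Matrix.det_fin_three]
    · ext i j; fin_cases i <;> fin_cases j <;> simp
    · ext i j; fin_cases i <;> fin_cases j <;> simp [Matrix.mul_apply, Fin.sum_univ_three, h1, h2, h3]
  · refine PencilEquiv.of_mul_eq 1 !![1, 0, 0; 0, 0, 1; 0, 1, 0] 1 0 0 1 (by simp) ?_ (by simp) ?_ ?_
    · simp [Matrix.det_fin_three]
    · ext i j; fin_cases i <;> fin_cases j <;> simp
    · ext i j; fin_cases i <;> fin_cases j <;> simp [Matrix.mul_apply, Fin.sum_univ_three, h1, h2, h3]

/-- Pencils whose first slice is `E₀₀` and whose second slice lives in the first row and column. -/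
theorem hasNormalForm_cross (hS : NormalizesRootless S δ γ) {p x₁ x₂ y₁ y₂ : F} :
    HasNormalForm S δ γ (!![1, 0, 0; 0, 0, 0; 0, 0, 0], !![p, y₁, y₂; x₁, 0, 0; x₂, 0, 0]) := by
  -- a row vector `(y₁, y₂)` extends to an invertible matrix, which is used for column operations
  have ext_y : ∀ y₁ y₂ : F, ¬ (y₁ = 0 ∧ y₂ = 0) → ∃ c d : F, y₁ * d - y₂ * c ≠ 0 := by
    intro y₁ y₂ h
    by_cases h1 : y₁ = 0
    · exact ⟨1, 0, by simpa [h1] using fun h2 => h ⟨h1, h2⟩⟩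
    · exact ⟨0, 1, by simpa using h1⟩
  have row : ∀ {p y₁ y₂ : F}, ¬ (y₁ = 0 ∧ y₂ = 0) → HasNormalForm S δ γ
      (!![1, 0, 0; 0, 0, 0; 0, 0, 0], !![p, y₁, y₂; 0, 0, 0; 0, 0, 0]) := fun {p y₁ y₂} hy => by
    obtain ⟨c, d, hcd⟩ := ext_y y₁ y₂ hy
    refine hS.hasNormalForm .L₁ (PencilEquiv.of_mul_eq 1 !![1, 0, 0; 0, y₁, y₂; 0, c, d]
      1 0 (-p) 1 (by simp) ?_ (by simp) ?_ ?_)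
    · simpa [Matrix.det_fin_three] using hcd
    · ext i j; fin_cases i <;> fin_cases j <;> simp [NormalForm.pencil]
    · ext i j; fin_cases i <;> fin_cases j <;> simp [NormalForm.pencil]
  by_cases hx : x₁ = 0 ∧ x₂ = 0 <;> by_cases hy : y₁ = 0 ∧ y₂ = 0
  · obtain ⟨rfl, rfl⟩ := hx
    obtain ⟨rfl, rfl⟩ := hy
    refine hS.hasNormalForm .rankOne (PencilEquiv.of_mul_eq 1 1 1 0 (-p) 1 (by simp) (by simp)
      (by simp) ?_ ?_) <;>
    · ext i j; fin_cases i <;> fin_cases j <;> simp [NormalForm.pencil]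
  · obtain ⟨rfl, rfl⟩ := hx
    exact row hy
  · obtain ⟨rfl, rfl⟩ := hy
    refine HasNormalForm.of_transpose hS ?_
    convert row (p := p) hx using 2
    · ext i j; fin_cases i <;> fin_cases j <;> rfl
    · ext i j; fin_cases i <;> fin_cases j <;> rfl
  · obtain ⟨c, d, hcd⟩ := ext_y y₁ y₂ hy
    obtain ⟨c', d', hcd'⟩ := ext_y x₁ x₂ hx
    obtain ⟨D, hD⟩ : ∃ D, D = x₁ * d' - x₂ * c' := ⟨_, rfl⟩
    rw [← hD] at hcd'
    -- the rows of `P` send `(x₁, x₂)` to `(1, 0)`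
    refine hS.hasNormalForm .squareDouble (PencilEquiv.of_mul_eq
      !![0, d' / D, -c' / D; 1, 0, 0; 0, -x₂, x₁] !![0, y₁, y₂; 1, 0, 0; 0, c, d]
      (-p) 1 1 0 ?_ ?_ (by simp) ?_ ?_)
    · have e : (!![0, d' / D, -c' / D; 1, 0, 0; 0, -x₂, x₁]).det = -1 := by
        simp [Matrix.det_fin_three]; field_simp; rw [hD]; ring
      rw [e]
      exact neg_ne_zero.2 one_ne_zero
    · have e : (!![0, y₁, y₂; 1, 0, 0; 0, c, d]).det = -(y₁ * d - y₂ * c) := by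
        simp [Matrix.det_fin_three]; ring
      rw [e]
      exact neg_ne_zero.2 hcd
    · ext i j; fin_cases i <;> fin_cases j <;> simp [NormalForm.pencil]
      · field_simp; rw [hD]; ring
      · ring
    · ext i j; fin_cases i <;> fin_cases j <;> simp [NormalForm.pencil]

/-- Pencils whose first slice has rank one. -/
theorem hasNormalForm_of_rank_one (hS : NormalizesRootless S δ γ) (B : Matrix (Fin 3) (Fin 3) F) :
    HasNormalForm S δ γ (!![1, 0, 0; 0, 0, 0; 0, 0, 0], B) := by
  have h2 : (Equiv.swap 1 2 : Equiv.Perm (Fin 3)) 1 = 2 := by decide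
  by_cases h11 : B 1 1 = 0
  · by_cases h21 : B 2 1 = 0
    · by_cases h12 : B 1 2 = 0
      · by_cases h22 : B 2 2 = 0
        · rw [Matrix.eta_fin_three B, h11, h12, h21, h22]
          exact hasNormalForm_cross hS
        · refine HasNormalForm.of_pencilEquiv ((pencilEquiv_swap B).1.trans (pencilEquiv_swap _).2)
            (hasNormalForm_of_rank_one_of_pivot hS ?_)
          simpa [h2] using h22
      · refine HasNormalForm.of_pencilEquiv (pencilEquiv_swap B).2
          (hasNormalForm_of_rank_one_of_pivot hS ?_)
        simpa [h2] using h12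
    · refine HasNormalForm.of_pencilEquiv (pencilEquiv_swap B).1
        (hasNormalForm_of_rank_one_of_pivot hS ?_)
      simpa [h2] using h21
  · exact hasNormalForm_of_rank_one_of_pivot hS h11

/-! ### Pencils without singular members -/

/-- If `B` is annihilated by a rootless cubic, then `B` is similar to its companion matrix. -/
theorem pencilEquiv_companion {a b c : F} (h : ∀ x : F, x ^ 3 - a * x ^ 2 - b * x - c ≠ 0)
    {B : Matrix (Fin 3) (Fin 3) F} (hB : B ^ 3 = a • B ^ 2 + b • B + c • (1 : Matrix (Fin 3) (Fin 3) F)) :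
    PencilEquiv (1, B) (1, !![0, 0, c; 1, 0, b; 0, 1, a]) := by
  set v : Fin 3 → F := ![1, 0, 0] with hv
  have hv0 : v ≠ 0 := by simp [hv]
  have hB3 : ∀ u : Fin 3 → F, B *ᵥ B *ᵥ B *ᵥ u = a • B *ᵥ B *ᵥ u + b • B *ᵥ u + c • u := by
    intro u
    have := congrArg (· *ᵥ u) hB
    simpa [pow_succ, Matrix.add_mulVec, Matrix.smul_mulVec, ← Matrix.mulVec_mulVec] using this
  -- an eigenvalue of `B` would be a root of the cubic
  have eig : ∀ (u : Fin 3 → F) (x : F), B *ᵥ u = x • u → u = 0 := by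
    intro u x hu
    have h3 := hB3 u
    simp only [hu, Matrix.mulVec_smul, smul_smul, ← add_smul] at h3
    by_contra hu0
    refine h x ?_
    have : (x ^ 3 - a * x ^ 2 - b * x - c) • u = 0 := by
      linear_combination (norm := module) h3
    exact (smul_eq_zero.1 this).resolve_right hu0
  have lin : ∀ (u : Fin 3 → F) (x y : F), x • u + y • B *ᵥ u = 0 → u ≠ 0 → x = 0 ∧ y = 0 := by
    intro u x y hxy hu
    by_cases hy : y = 0
    · subst hy
      simpa [hu] using hxy
    · refine absurd (eig u (-x / y) ?_) hu
      have : y • (B *ᵥ u - (-x / y) • u) = 0 := by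
        rw [smul_sub, smul_smul, mul_div_cancel₀ _ hy]
        linear_combination (norm := module) hxy
      exact sub_eq_zero.1 ((smul_eq_zero.1 this).resolve_left hy)
  -- `v`, `B v` and `B² v` are linearly independent: a relation would give a factor of the cubic
  set P : Matrix (Fin 3) (Fin 3) F := !![v 0, (B *ᵥ v) 0, (B *ᵥ B *ᵥ v) 0;
    v 1, (B *ᵥ v) 1, (B *ᵥ B *ᵥ v) 1; v 2, (B *ᵥ v) 2, (B *ᵥ B *ᵥ v) 2] with hPdef
  have hPx : ∀ x : Fin 3 → F, P *ᵥ x = x 0 • v + x 1 • B *ᵥ v + x 2 • B *ᵥ B *ᵥ v := by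
    rw [hPdef]
    generalize B *ᵥ B *ᵥ v = r
    generalize B *ᵥ v = q
    intro x
    ext i; fin_cases i <;>
      simp [Matrix.mulVec, dotProduct, Fin.sum_univ_three] <;> ring
  have hP : P.det ≠ 0 := by
    intro h0
    obtain ⟨x, hx, hPx0⟩ := Matrix.exists_mulVec_eq_zero_iff.2 h0
    rw [hPx] at hPx0
    have hx2 : x 2 ≠ 0 := by
      intro hx2
      rw [hx2, zero_smul, add_zero] at hPx0
      obtain ⟨e₁, e₂⟩ := lin v _ _ hPx0 hv0
      exact hx (by ext i; fin_cases i <;> simp [e₁, e₂, hx2])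
    obtain ⟨l, m, hlm⟩ : ∃ l m : F, B *ᵥ B *ᵥ v = l • B *ᵥ v + m • v := by
      refine ⟨-x 1 / x 2, -x 0 / x 2, ?_⟩
      have : x 2 • (B *ᵥ B *ᵥ v - ((-x 1 / x 2) • B *ᵥ v + (-x 0 / x 2) • v)) = 0 := by
        rw [smul_sub, smul_add, smul_smul, smul_smul, mul_div_cancel₀ _ hx2, mul_div_cancel₀ _ hx2]
        linear_combination (norm := module) hPx0
      exact sub_eq_zero.1 ((smul_eq_zero.1 this).resolve_left hx2)
    have h3 := hB3 v
    rw [hlm, Matrix.mulVec_add, Matrix.mulVec_smul, Matrix.mulVec_smul, hlm] at h3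
    obtain ⟨e₁, e₂⟩ := lin v (l * m - a * m - c) (l * l + m - a * l - b)
      (by linear_combination (norm := module) h3) hv0
    -- the cubic is `(x² - l x - m) (x - (a - l))`
    refine h (a - l) ?_
    linear_combination e₁ + (a - l) * e₂
  have hBP : B * P = P * !![0, 0, c; 1, 0, b; 0, 1, a] := by
    refine Matrix.ext_of_mulVec_single fun j => ?_
    rw [← Matrix.mulVec_mulVec, ← Matrix.mulVec_mulVec]
    generalize (Pi.single j 1 : Fin 3 → F) = x
    have hx : !![0, 0, c; 1, 0, b; 0, 1, a] *ᵥ x = ![c * x 2, x 0 + b * x 2, x 1 + a * x 2] := by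
      ext i; fin_cases i <;> simp [Matrix.mulVec, dotProduct, Fin.sum_univ_three]
    rw [hx, hPx, hPx, Matrix.mulVec_add, Matrix.mulVec_add, Matrix.mulVec_smul, Matrix.mulVec_smul,
      Matrix.mulVec_smul, hB3]
    simp only [Matrix.cons_val]
    module
  refine (PencilEquiv.of_mul_eq P P 1 0 0 1 hP hP (by simp) (by simp) ?_).symm
  simpa using hBP.symm

/-- Pencils whose first slice is invertible. -/
theorem hasNormalForm_of_rank_three (hS : NormalizesRootless S δ γ) (B : Matrix (Fin 3) (Fin 3) F) :
    HasNormalForm S δ γ (1, B) := by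
  by_cases h : ∃ x : F, B.charpoly.eval x = 0
  · -- `B - x` is singular, so that the pencil has a member of rank at most two
    obtain ⟨x, hx⟩ := h
    have hdet : (B - x • (1 : Matrix (Fin 3) (Fin 3) F)).det = 0 := by
      rw [Matrix.eval_charpoly, ← neg_eq_zero] at hx
      rw [← hx, ← neg_sub, Matrix.det_neg, Matrix.smul_one_eq_diagonal]
      simp [Matrix.scalar_apply]
      ring
    obtain ⟨P, Q, hP, hQ, hPQ⟩ := exists_rank_normal_form (B - x • (1 : Matrix (Fin 3) (Fin 3) F))
    have h1 : PencilEquiv (1, B) (P * (B - x • (1 : Matrix (Fin 3) (Fin 3) F)) * Q, P * 1 * Q) :=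
      ⟨P, Q, -x, 1, 1, 0, hP, hQ, by simp, by simp [sub_eq_neg_add], by simp⟩
    refine HasNormalForm.of_pencilEquiv h1 ?_
    rcases hPQ with h0 | h0 | h0 | h0
    · have hdP : IsUnit (P * 1 * Q).det := isUnit_iff_ne_zero.2 (by simp [hP, hQ])
      rw [h0]
      refine hS.hasNormalForm .rankThree (PencilEquiv.of_mul_eq (P * 1 * Q)⁻¹ 1 0 1 1 0 ?_ (by simp)
        (by simp) ?_ ?_)
      · simp [Matrix.det_nonsing_inv, hP, hQ]
      · simp only [zero_smul, one_smul, zero_add, Matrix.nonsing_inv_mul _ hdP]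
        simp [NormalForm.pencil, Matrix.one_fin_three]
      · simp [NormalForm.pencil]
    · rw [h0]
      exact hasNormalForm_of_rank_one hS _
    · rw [h0]
      exact hasNormalForm_of_rank_two hS _
    · have := congrArg Matrix.det h0
      simp [hdet] at this
  · push Not at h
    have hdeg : B.charpoly.natDegree = 3 := by simp
    have hmonic : B.charpoly.coeff 3 = 1 := by
      have := B.charpoly_monic
      rwa [Polynomial.Monic, Polynomial.leadingCoeff, hdeg] at this
    have hroot : ∀ x : F, x ^ 3 - (-B.charpoly.coeff 2) * x ^ 2 - (-B.charpoly.coeff 1) * x -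
        (-B.charpoly.coeff 0) ≠ 0 := by
      intro x
      have := h x
      rw [Polynomial.eval_eq_sum_range, hdeg] at this
      simp only [Finset.sum_range_succ, Finset.sum_range_zero, hmonic] at this
      intro h0
      exact this (by linear_combination h0)
    obtain ⟨hc, hc'⟩ := hS.cubic _ _ _ hroot
    refine ⟨_, hc, (pencilEquiv_companion hroot ?_).trans hc'⟩
    have := Matrix.aeval_self_charpoly B
    rw [Polynomial.aeval_eq_sum_range, hdeg] at this
    simp only [Finset.sum_range_succ, Finset.sum_range_zero, hmonic] at this
    linear_combination (norm := skip) this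
    simp only [pow_zero, pow_one, neg_smul, one_smul]
    abel

/-- Every pencil has a normal form. -/
theorem NormalizesRootless.exists_normalForm (hS : NormalizesRootless S δ γ) (X : Pencil F) :
    HasNormalForm S δ γ X := by
  have aux : ∀ Y : Pencil F, Y.1 ≠ 0 → HasNormalForm S δ γ Y := by
    rintro ⟨A, B⟩ hA
    obtain ⟨P, Q, hP, hQ, hPQ⟩ := exists_rank_normal_form A
    refine HasNormalForm.of_pencilEquiv (PencilEquiv.mul_mul _ hP hQ) ?_
    change HasNormalForm S δ γ (P * A * Q, P * B * Q)
    rcases hPQ with h0 | h0 | h0 | h0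
    · refine absurd ?_ hA
      have h1 := congrArg (fun M => P⁻¹ * M * Q⁻¹) h0
      simpa [Matrix.mul_assoc, Matrix.nonsing_inv_mul_cancel_left _ _ (isUnit_iff_ne_zero.2 hP),
        Matrix.mul_nonsing_inv _ (isUnit_iff_ne_zero.2 hQ)] using h1
    · rw [h0]
      exact hasNormalForm_of_rank_one hS _
    · rw [h0]
      exact hasNormalForm_of_rank_two hS _
    · rw [h0]
      exact hasNormalForm_of_rank_three hS _
  by_cases h1 : X.1 = 0
  · by_cases h2 : X.2 = 0
    · refine hS.hasNormalForm .zero ?_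
      rw [show X = NormalForm.zero.pencil δ γ from Prod.ext h1 h2]
      exact PencilEquiv.refl _
    · refine HasNormalForm.of_pencilEquiv (PencilEquiv.mix X (a := 0) (b := 1) (c := 1) (d := 0)
        (by simp)) (aux _ ?_)
      simpa using h2
  · exact aux X h1

end

/-! ### Rootless quadratics and cubics -/

section

universe u

variable {F : Type u} [Field F]

/-- Over a finite field, irreducible polynomials of the same degree acquire a root in the same
extension, since there is only one extension of each degree. -/
theorem exists_field_with_roots [Finite F] {p q : Polynomial F} (hp : Irreducible p)
    (hq : Irreducible q) (h : p.natDegree = q.natDegree) :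
    ∃ (K : Type u) (_ : Field K) (_ : Algebra F K), Module.finrank F K = p.natDegree ∧
      (∃ α : K, Polynomial.aeval α p = 0) ∧ ∃ β : K, Polynomial.aeval β q = 0 := by
  have := Fact.mk hp
  have := Fact.mk hq
  have hfp : Module.finrank F (AdjoinRoot p) = p.natDegree := by
    simpa using (AdjoinRoot.powerBasis hp.ne_zero).finrank
  have hfq : Module.finrank F (AdjoinRoot q) = q.natDegree := by
    simpa using (AdjoinRoot.powerBasis hq.ne_zero).finrank
  have hpos : 0 < Module.finrank F (AdjoinRoot p) := hfp ▸ hp.natDegree_pos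
  have := Module.finite_of_finrank_pos hpos
  have : Finite (AdjoinRoot p) := Module.finite_of_finite F
  obtain ⟨f⟩ := FiniteField.nonempty_algHom_of_finrank_dvd (F := F) (K := AdjoinRoot q)
    (L := AdjoinRoot p) (by rw [hfp, hfq, h])
  refine ⟨AdjoinRoot p, inferInstance, inferInstance, hfp, ⟨AdjoinRoot.root p, by simp⟩,
    f (AdjoinRoot.root q), ?_⟩
  rw [Polynomial.aeval_algHom_apply]
  simp

open Polynomial in
theorem irreducible_quadratic {τ d : F} (h : ∀ x : F, x ^ 2 - τ * x + d ≠ 0) :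
    (X ^ 2 - C τ * X + C d).natDegree = 2 ∧ Irreducible (X ^ 2 - C τ * X + C d) := by
  have hdeg : (X ^ 2 - C τ * X + C d).natDegree = 2 := by compute_degree!
  refine ⟨hdeg, (irreducible_iff_roots_eq_zero_of_degree_le_three (by omega) (by omega)).2 ?_⟩
  refine Multiset.eq_zero_of_forall_notMem fun x hx => h x ?_
  have := (mem_roots'.1 hx).2
  simpa [IsRoot] using this

open Polynomial in
theorem irreducible_cubic {a b c : F} (h : ∀ x : F, x ^ 3 - a * x ^ 2 - b * x - c ≠ 0) :
    (X ^ 3 - C a * X ^ 2 - C b * X - C c).natDegree = 3 ∧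
      Irreducible (X ^ 3 - C a * X ^ 2 - C b * X - C c) := by
  have hdeg : (X ^ 3 - C a * X ^ 2 - C b * X - C c).natDegree = 3 := by compute_degree!
  refine ⟨hdeg, (irreducible_iff_roots_eq_zero_of_degree_le_three (by omega) (by omega)).2 ?_⟩
  refine Multiset.eq_zero_of_forall_notMem fun x hx => h x ?_
  have := (mem_roots'.1 hx).2
  simpa [IsRoot] using this

/-- Linear independence of `1` and an element `α` outside the base field. -/
theorem exists_smul_add_eq_zero {K : Type*} [Field K] [Algebra F K] {α : K}
    (hα : ∀ x : F, algebraMap F K x ≠ α) {x y : F}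
    (h : algebraMap F K x + algebraMap F K y * α = 0) : x = 0 ∧ y = 0 := by
  by_cases hy : y = 0
  · subst hy
    simpa using h
  · refine absurd ?_ (hα (-x / y))
    have hy' : algebraMap F K y ≠ 0 := by simpa using hy
    rw [map_div₀, map_neg]
    field_simp
    linear_combination -h

/-- Any two rootless monic quadratics over a finite field differ by an affine substitution. -/
theorem exists_affine_of_finite [Finite F] {τ d δ : F} (hδ : ∀ x : F, x ^ 2 - x + δ ≠ 0)
    (h : ∀ x : F, x ^ 2 - τ * x + d ≠ 0) :
    ∃ l m : F, m ≠ 0 ∧ τ = 2 * l + m ∧ d = l ^ 2 + l * m + m ^ 2 * δ := by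
  obtain ⟨hdeg, hirr⟩ := irreducible_quadratic (τ := 1) (d := δ) (by simpa using hδ)
  obtain ⟨hdeg', hirr'⟩ := irreducible_quadratic h
  obtain ⟨K, _, _, hK, ⟨α, hα⟩, β, hβ⟩ := exists_field_with_roots hirr hirr' (by rw [hdeg, hdeg'])
  rw [hdeg] at hK
  simp only [map_add, map_sub, map_mul, map_pow, map_one, one_mul, Polynomial.aeval_X,
    Polynomial.aeval_C] at hα hβ
  have hαF : ∀ x : F, algebraMap F K x ≠ α := by
    rintro x rfl
    exact hδ x ((algebraMap F K).injective (by simpa using hα))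
  have hβF : ∀ x : F, algebraMap F K x ≠ β := by
    rintro x rfl
    exact h x ((algebraMap F K).injective (by simpa using hβ))
  -- `1`, `α` and `β` are linearly dependent, so `β = l + m α`
  obtain ⟨l, m, hlm⟩ : ∃ l m : F, β = algebraMap F K l + algebraMap F K m * α := by
    have hdep : ¬ LinearIndependent F ![1, α, β] := fun hli => by
      have := Module.finite_of_finrank_pos (R := F) (M := K) (by omega)
      have := hli.fintype_card_le_finrank
      rw [hK] at this
      simp at this
    obtain ⟨g, hg, i, hi⟩ := Fintype.not_linearIndependent_iff.1 hdep
    simp only [Fin.sum_univ_three, Matrix.cons_val, Algebra.smul_def, mul_one] at hg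
    have hg2 : g 2 ≠ 0 := by
      intro h2
      rw [h2, map_zero, zero_mul, add_zero] at hg
      obtain ⟨h0, h1⟩ := exists_smul_add_eq_zero hαF hg
      fin_cases i <;> simp_all
    have hg2' : algebraMap F K (g 2) ≠ 0 := by simpa using hg2
    refine ⟨-g 0 / g 2, -g 1 / g 2, ?_⟩
    rw [map_div₀, map_div₀, map_neg, map_neg]
    field_simp
    linear_combination hg
  have hm : m ≠ 0 := by
    rintro rfl
    exact hβF l (by simp [hlm])
  -- comparing coefficients in the equation of `β`
  have key : algebraMap F K (l ^ 2 - m ^ 2 * δ - τ * l + d) +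
      algebraMap F K (m * (2 * l + m - τ)) * α = 0 := by
    simp only [map_add, map_sub, map_mul, map_pow, map_ofNat]
    rw [hlm] at hβ
    linear_combination hβ - (algebraMap F K m) ^ 2 * hα
  obtain ⟨h0, h1⟩ := exists_smul_add_eq_zero hαF key
  have hτ := (mul_eq_zero.1 h1).resolve_left hm
  exact ⟨l, m, hm, by linear_combination -hτ, by linear_combination h0 - l * hτ⟩

theorem pencilEquiv_regularCubic (δ γ : F) :
    PencilEquiv ((1, !![0, 0, γ; 1, 0, 1; 0, 1, 0]) : Pencil F)
      (NormalForm.regularCubic.pencil δ γ) := by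
  refine PencilEquiv.of_mul_eq !![0, 0, 1; 0, 1, 0; 1, 0, 1] 1 1 0 0 1 ?_ (by simp) (by simp) ?_ ?_
  · simp [Matrix.det_fin_three]
  · ext i j; fin_cases i <;> fin_cases j <;> simp [NormalForm.pencil]
  · ext i j; fin_cases i <;> fin_cases j <;> simp [NormalForm.pencil]

/-- Over a finite field all rootless cubics give equivalent pencils: a cubic extension is generated
by roots `α`, `β` of two of them, and `1, α, β, αβ` are linearly dependent, so that `β` is a fractional
linear transform of `α`. -/
theorem pencilEquiv_of_rootless_cubic [Finite F] {a b c a' b' c' : F}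
    (h : ∀ x : F, x ^ 3 - a * x ^ 2 - b * x - c ≠ 0)
    (h' : ∀ x : F, x ^ 3 - a' * x ^ 2 - b' * x - c' ≠ 0) :
    PencilEquiv ((1, !![0, 0, c; 1, 0, b; 0, 1, a]) : Pencil F)
      (1, !![0, 0, c'; 1, 0, b'; 0, 1, a']) := by
  obtain ⟨hdeg, hirr⟩ := irreducible_cubic h
  obtain ⟨hdeg', hirr'⟩ := irreducible_cubic h'
  obtain ⟨K, _, _, hK, ⟨α, hα⟩, β, hβ⟩ := exists_field_with_roots hirr hirr' (by rw [hdeg, hdeg'])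
  rw [hdeg] at hK
  simp only [map_sub, map_mul, map_pow, Polynomial.aeval_X, Polynomial.aeval_C] at hα hβ
  have hαF : ∀ x : F, algebraMap F K x ≠ α := by
    rintro x rfl
    exact h x ((algebraMap F K).injective (by simpa using hα))
  have hβF : ∀ x : F, algebraMap F K x ≠ β := by
    rintro x rfl
    exact h' x ((algebraMap F K).injective (by simpa using hβ))
  have := Module.finite_of_finrank_pos (R := F) (M := K) (by omega)
  obtain ⟨g, hg, hg0⟩ : ∃ g : Fin 4 → F, algebraMap F K (g 0) + algebraMap F K (g 1) * α +
      (algebraMap F K (g 2) + algebraMap F K (g 3) * α) * β = 0 ∧ ∃ i, g i ≠ 0 := by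
    have hdep : ¬ LinearIndependent F ![1, α, β, α * β] := fun hli => by
      have := hli.fintype_card_le_finrank
      rw [hK] at this
      simp at this
    obtain ⟨g, hg, hi⟩ := Fintype.not_linearIndependent_iff.1 hdep
    simp only [Fin.sum_univ_four, Matrix.cons_val, Algebra.smul_def, mul_one] at hg
    exact ⟨g, by linear_combination hg, hi⟩
  set e : K := algebraMap F K (g 2) + algebraMap F K (g 3) * α with he
  have he0 : e ≠ 0 := by
    intro h0
    rw [h0, zero_mul, add_zero] at hg
    obtain ⟨h1, h2⟩ := exists_smul_add_eq_zero hαF hg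
    obtain ⟨h3, h4⟩ := exists_smul_add_eq_zero hαF h0
    obtain ⟨i, hi⟩ := hg0
    fin_cases i <;> simp_all
  have hD : g 2 * -g 1 - g 3 * -g 0 ≠ 0 := by
    intro hD
    have hD' := congrArg (algebraMap F K) hD
    simp only [map_sub, map_mul, map_neg, map_zero] at hD'
    -- otherwise `g₁ + g₃ β = 0` or `g₀ + g₂ β = 0`
    have e₁ : algebraMap F K (g 1) + algebraMap F K (g 3) * β = 0 := by
      refine (mul_eq_zero.1 (?_ : e * _ = 0)).resolve_left he0
      rw [he]
      rw [he] at hg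
      linear_combination algebraMap F K (g 3) * hg - hD'
    have e₂ : algebraMap F K (g 0) + algebraMap F K (g 2) * β = 0 := by
      linear_combination hg - α * e₁
    obtain ⟨h1, h2⟩ := exists_smul_add_eq_zero hβF e₁
    obtain ⟨h3, h4⟩ := exists_smul_add_eq_zero hβF e₂
    obtain ⟨i, hi⟩ := hg0
    fin_cases i <;> simp_all
  -- multiplication by elements of `K`, as matrices
  let Φ : K →ₐ[F] Matrix (Fin 3) (Fin 3) F :=
    Algebra.leftMulMatrix (Module.finBasisOfFinrankEq F K hK)
  have hΦ : ∀ x : F, Φ (algebraMap F K x) = x • (1 : Matrix (Fin 3) (Fin 3) F) := fun x => by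
    rw [AlgHom.commutes, Algebra.algebraMap_eq_smul_one]
  have hΦdet : (Φ e).det ≠ 0 := by
    intro h0
    have h1 : Φ e * Φ e⁻¹ = 1 := by rw [← map_mul, mul_inv_cancel₀ he0, map_one]
    have := congrArg Matrix.det h1
    simp [h0] at this
  have hA : PencilEquiv (1, Φ α) (1, !![0, 0, c; 1, 0, b; 0, 1, a]) := by
    refine pencilEquiv_companion h ?_
    have := congrArg Φ hα
    simp only [map_sub, map_mul, map_pow, hΦ, map_zero, smul_mul_assoc, one_mul] at this
    linear_combination (norm := module) this
  have hB : PencilEquiv (1, Φ β) (1, !![0, 0, c'; 1, 0, b'; 0, 1, a']) := by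
    refine pencilEquiv_companion h' ?_
    have := congrArg Φ hβ
    simp only [map_sub, map_mul, map_pow, hΦ, map_zero, smul_mul_assoc, one_mul] at this
    linear_combination (norm := module) this
  refine hA.symm.trans (PencilEquiv.trans ?_ hB)
  refine (PencilEquiv.mix (1, Φ α) hD).trans (PencilEquiv.of_mul_eq (Φ e) 1 1 0 0 1 hΦdet
    (by simp) (by simp) ?_ ?_).symm
  · simp [he, hΦ]
  · have := congrArg Φ hg
    simp only [map_add, map_mul, hΦ, map_zero, smul_mul_assoc, one_mul] at this
    simp only [zero_smul, one_smul, zero_add, Matrix.mul_one]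
    linear_combination (norm := module) this

theorem normalizesRootless_of_finite [Finite F] {δ γ : F} (hδ : ∀ x : F, x ^ 2 - x + δ ≠ 0)
    (hγ : ∀ x : F, x ^ 3 - x - γ ≠ 0) : NormalizesRootless Finset.univ δ γ where
  split _ _ _ _ := Finset.mem_univ _
  quadratic _ _ h := ⟨Finset.mem_univ _, Finset.mem_univ _, exists_affine_of_finite hδ h⟩
  cubic _ _ _ h := ⟨Finset.mem_univ _, (pencilEquiv_of_rootless_cubic h
    (a' := 0) (b' := 1) (by simpa using hγ)).trans (pencilEquiv_regularCubic δ γ)⟩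

/-- Over a finite field a map with `0` and `1` in one fibre misses some value. -/
theorem exists_rootless_of_finite [Finite F] :
    (∃ δ : F, ∀ x : F, x ^ 2 - x + δ ≠ 0) ∧ ∃ γ : F, ∀ x : F, x ^ 3 - x - γ ≠ 0 := by
  have key : ∀ f : F → F, f 0 = f 1 → ∃ y, ∀ x, f x ≠ y := by
    intro f h01
    by_contra! hf
    exact zero_ne_one (Finite.injective_iff_surjective.2 hf h01)
  constructor
  · obtain ⟨y, hy⟩ := key (fun x => x ^ 2 - x) (by simp)
    exact ⟨-y, fun x h => hy x (by linear_combination h)⟩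
  · obtain ⟨y, hy⟩ := key (fun x => x ^ 3 - x) (by simp)
    exact ⟨y, fun x h => hy x (by linear_combination h)⟩

open Polynomial in
theorem normalizesRootless_of_isAlgClosed [IsAlgClosed F] (δ γ : F) :
    NormalizesRootless {i | i ≠ .squareQuadratic ∧ i ≠ .regularQuadratic ∧ i ≠ .regularCubic} δ γ where
  split i h1 h2 h3 := by simp [h1, h2, h3]
  quadratic τ d h := by
    obtain ⟨hdeg, -⟩ := irreducible_quadratic h
    obtain ⟨x, hx⟩ := IsAlgClosed.exists_root (X ^ 2 - C τ * X + C d)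
      (fun h0 => by rw [natDegree_eq_of_degree_eq_some h0] at hdeg; simp at hdeg)
    exact absurd (by simpa [IsRoot] using hx) (h x)
  cubic a b c h := by
    obtain ⟨hdeg, -⟩ := irreducible_cubic h
    obtain ⟨x, hx⟩ := IsAlgClosed.exists_root (X ^ 3 - C a * X ^ 2 - C b * X - C c)
      (fun h0 => by rw [natDegree_eq_of_degree_eq_some h0] at hdeg; simp at hdeg)
    exact absurd (by simpa [IsRoot] using hx) (h x)

/-- A real cubic has a root, since it changes sign between `-M` and `M` for `M = 1 + |a| + |b| + |c|`. A
rootless real quadratic has negative discriminant, and is made proportional to `x² - x + 1`, of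
discriminant `-3`, by an affine substitution. -/
theorem normalizesRootless_real (γ : ℝ) :
    NormalizesRootless ({i | i ≠ .regularCubic} : Finset NormalForm) (1 : ℝ) γ where
  split i _ _ h3 := by simp [h3]
  quadratic τ d h := by
    refine ⟨by simp, by simp, ?_⟩
    have hdisc : 0 < (4 * d - τ ^ 2) / 3 := by
      by_contra! hcon
      -- otherwise the quadratic formula gives a root
      have hs := Real.sq_sqrt (show 0 ≤ (τ ^ 2 - 4 * d) / 4 by linarith)
      exact h (τ / 2 + √((τ ^ 2 - 4 * d) / 4)) (by linear_combination hs)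
    have hs := Real.sq_sqrt hdisc.le
    exact ⟨(τ - √((4 * d - τ ^ 2) / 3)) / 2, √((4 * d - τ ^ 2) / 3), (Real.sqrt_pos.2 hdisc).ne',
      by ring, by linear_combination -(3 / 4) * hs⟩
  cubic a b c h := by
    exfalso
    set M := 1 + |a| + |b| + |c|
    have hM : 1 ≤ M := by
      have := abs_nonneg a
      have := abs_nonneg b
      have := abs_nonneg c
      linarith
    have bound : ∀ x : ℝ, |x| = M → |a * x ^ 2 + b * x + c| ≤ M ^ 3 := by
      intro x hx
      calc |a * x ^ 2 + b * x + c| ≤ |a| * M ^ 2 + |b| * M + |c| := by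
            refine (abs_add_le _ _).trans (add_le_add ((abs_add_le _ _).trans ?_) le_rfl)
            rw [abs_mul, abs_mul, abs_pow, hx]
        _ ≤ |a| * M ^ 2 + |b| * M ^ 2 + |c| * M ^ 2 := by
            have h1 : M ≤ M ^ 2 := by nlinarith
            have h2 : 1 ≤ M ^ 2 := by nlinarith
            have := mul_le_mul_of_nonneg_left h1 (abs_nonneg b)
            have := mul_le_mul_of_nonneg_left h2 (abs_nonneg c)
            linarith
        _ ≤ M ^ 3 := by
            rw [show M ^ 3 = (1 + |a| + |b| + |c|) * M ^ 2 by ring]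
            nlinarith [sq_nonneg M]
    have hcont : Continuous fun x : ℝ => x ^ 3 - a * x ^ 2 - b * x - c := by fun_prop
    have h1 := abs_le.1 (bound M (abs_of_pos (by linarith)))
    have h2 := abs_le.1 (bound (-M) (by rw [abs_neg]; exact abs_of_pos (by linarith)))
    obtain ⟨x, hx⟩ := mem_range_of_exists_le_of_exists_ge hcont (c := 0)
      ⟨-M, by nlinarith⟩ ⟨M, by nlinarith⟩
    exact h x hx

end

/-! ### Linear families of fundamental tensors -/

section

variable {F : Type*} [Field F]

/-- Proportionality of vectors, in a form that is symmetric and allows zero vectors. -/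
def Par {ι : Type*} (p q : ι → F) : Prop := ∀ i j, p i * q j = p j * q i

theorem Par.symm {ι : Type*} {p q : ι → F} (h : Par p q) : Par q p := fun i j => by
  linear_combination -h i j

theorem Par.of_add {ι : Type*} {p q r : ι → F} (h₁ : Par p (q + r)) (h₂ : Par p q) : Par p r :=
  fun i j => by
    have := h₁ i j
    simp only [Pi.add_apply] at this
    linear_combination this - h₂ i j

theorem Par.exists_eq_smul {ι : Type*} {p q : ι → F} (hp : p ≠ 0) (h : Par p q) :
    ∃ r : F, q = r • p := by
  obtain ⟨i, hi⟩ := Function.ne_iff.1 hp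
  refine ⟨q i / p i, ?_⟩
  ext j
  have hi' : p i ≠ 0 := hi
  simp only [Pi.smul_apply, smul_eq_mul]
  field_simp
  linear_combination h i j

theorem Par.trans {ι : Type*} {p q r : ι → F} (hq : q ≠ 0) (h₁ : Par p q) (h₂ : Par q r) :
    Par p r := by
  obtain ⟨s, rfl⟩ := h₁.symm.exists_eq_smul hq
  obtain ⟨t, rfl⟩ := h₂.exists_eq_smul hq
  intro i j
  simp only [Pi.smul_apply, smul_eq_mul]
  ring

/-- An array of scalars that is a product `a i * b j * c k` with nonzero `a`, `b`, `c`: the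
coordinates of a fundamental tensor. -/
def IsPure {ι₁ ι₂ ι₃ : Type*} (f : ι₁ → ι₂ → ι₃ → F) : Prop :=
  ∃ (a : ι₁ → F) (b : ι₂ → F) (c : ι₃ → F), a ≠ 0 ∧ b ≠ 0 ∧ c ≠ 0 ∧
    ∀ i j k, f i j k = a i * b j * c k

section

variable {ι₁ ι₂ ι₃ : Type*}

/-- If the sum of two pure tensors is pure and the first factors are not proportional, then the other
factors are. -/
theorem par_of_add_eq {a a' a'' : ι₁ → F} {b b' b'' : ι₂ → F} {c c' c'' : ι₃ → F}
    (hb : b ≠ 0) (hb' : b' ≠ 0) (hc : c ≠ 0) (hc' : c' ≠ 0)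
    (h : ∀ i j k, a i * b j * c k + a' i * b' j * c' k = a'' i * b'' j * c'' k)
    (ha : ¬ Par a a') : Par b b' ∧ Par c c' := by
  simp only [Par, not_forall] at ha
  obtain ⟨i, i', hi⟩ := ha
  set D := a i * a' i' - a i' * a' i with hD
  have hD0 : D ≠ 0 := sub_ne_zero.2 hi
  have e₁ : ∀ j k, D * (b j * c k) = (a' i' * a'' i - a' i * a'' i') * (b'' j * c'' k) :=
    fun j k => by rw [hD]; linear_combination a' i' * h i j k - a' i * h i' j k
  have e₂ : ∀ j k, D * (b' j * c' k) = (a i * a'' i' - a i' * a'' i) * (b'' j * c'' k) :=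
    fun j k => by rw [hD]; linear_combination a i * h i' j k - a i' * h i j k
  obtain ⟨k, hk⟩ := Function.ne_iff.1 hc
  obtain ⟨k', hk'⟩ := Function.ne_iff.1 hc'
  obtain ⟨j, hj⟩ := Function.ne_iff.1 hb
  obtain ⟨j', hj'⟩ := Function.ne_iff.1 hb'
  constructor
  · intro x y
    have hne : D * D * c k * c' k' ≠ 0 := by simp_all
    refine mul_left_cancel₀ hne ?_
    linear_combination (D * (b' y * c' k')) * e₁ x k - (D * (b' x * c' k')) * e₁ y k +
      ((a' i' * a'' i - a' i * a'' i') * (b'' x * c'' k)) * e₂ y k' -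
      ((a' i' * a'' i - a' i * a'' i') * (b'' y * c'' k)) * e₂ x k'
  · intro x y
    have hne : D * D * b j * b' j' ≠ 0 := by simp_all
    refine mul_left_cancel₀ hne ?_
    linear_combination (D * (b' j' * c' y)) * e₁ j x - (D * (b' j' * c' x)) * e₁ j y +
      ((a' i' * a'' i - a' i * a'' i') * (b'' j * c'' x)) * e₂ j' y -
      ((a' i' * a'' i - a' i * a'' i') * (b'' j * c'' y)) * e₂ j' x

/-- At least two pairs of factors are proportional. For fundamental tensors this is necessary for their
sum to be fundamental. -/
def Adjacent (a a' : ι₁ → F) (b b' : ι₂ → F) (c c' : ι₃ → F) : Prop :=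
  (Par a a' ∧ Par b b') ∨ (Par a a' ∧ Par c c') ∨ (Par b b' ∧ Par c c')

theorem adjacent_of_add {a a' : ι₁ → F} {b b' : ι₂ → F} {c c' : ι₃ → F}
    (ha : a ≠ 0) (ha' : a' ≠ 0) (hb : b ≠ 0) (hb' : b' ≠ 0) (hc : c ≠ 0) (hc' : c' ≠ 0)
    (h : ∃ (a'' : ι₁ → F) (b'' : ι₂ → F) (c'' : ι₃ → F), ∀ i j k,
      a i * b j * c k + a' i * b' j * c' k = a'' i * b'' j * c'' k) :
    Adjacent a a' b b' c c' := by
  obtain ⟨a'', b'', c'', h⟩ := h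
  have h1 := par_of_add_eq hb hb' hc hc' h
  have h2 := par_of_add_eq (a := b) (a' := b') (a'' := b'') (b'' := a'') (c'' := c'') ha ha' hc hc'
    (fun j i k => by linear_combination h i j k)
  unfold Adjacent
  tauto

/-- If the third factors in a family of pairwise adjacent pure tensors are not all proportional, then
the first factors are proportional, and so are the second ones. -/
theorem par_of_adjacent {E : Type*} {p : E → Prop} {a : E → ι₁ → F} {b : E → ι₂ → F}
    {c : E → ι₃ → F} (ha : ∀ u, p u → a u ≠ 0) (hb : ∀ u, p u → b u ≠ 0) (hc : ∀ u, p u → c u ≠ 0)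
    (h : ∀ u v, p u → p v → Adjacent (a u) (a v) (b u) (b v) (c u) (c v))
    {u v : E} (hu : p u) (hv : p v) (huv : ¬ Par (c u) (c v)) (w : E) (hw : p w) :
    Par (a u) (a w) ∧ Par (b u) (b w) := by
  have huv' := h u v hu hv
  have huw := h u w hu hw
  have hvw := h v w hv hw
  by_cases hcw : Par (c u) (c w)
  · have hcv : ¬ Par (c v) (c w) := fun h' => huv (hcw.trans (hc w hw) h'.symm)
    simp only [Adjacent, huv, hcv, and_false, or_false] at huv' hvw
    exact ⟨huv'.1.trans (ha v hv) hvw.1, huv'.2.trans (hb v hv) hvw.2⟩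
  · simpa only [Adjacent, hcw, and_false, or_false] using huw

/-- A linear family of pure tensors with fixed first and second factor has a linear third factor. -/
theorem exists_linear_factor {E : Type*} [AddCommGroup E] [Module F E]
    (l : ι₁ → ι₂ → ι₃ → E →ₗ[F] F) {a : ι₁ → F} {b : ι₂ → F} (ha : a ≠ 0) (hb : b ≠ 0)
    (hl : ∀ u, u ≠ 0 → ∃ (a' : ι₁ → F) (b' : ι₂ → F) (c' : ι₃ → F), Par a a' ∧ Par b b' ∧ ∀ i j k,
      l i j k u = a' i * b' j * c' k) :
    ∃ φ : E →ₗ[F] ι₃ → F, ∀ u i j k, l i j k u = a i * b j * φ u k := by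
  obtain ⟨i₀, hi₀⟩ := Function.ne_iff.1 ha
  obtain ⟨j₀, hj₀⟩ := Function.ne_iff.1 hb
  refine ⟨LinearMap.pi fun k => (a i₀ * b j₀)⁻¹ • l i₀ j₀ k, fun u i j k => ?_⟩
  by_cases hu : u = 0
  · simp [hu]
  obtain ⟨a', b', c', ha', hb', h⟩ := hl u hu
  obtain ⟨r, rfl⟩ := ha'.exists_eq_smul ha
  obtain ⟨s, rfl⟩ := hb'.exists_eq_smul hb
  have hi₀' : a i₀ ≠ 0 := hi₀
  have hj₀' : b j₀ ≠ 0 := hj₀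
  simp only [LinearMap.pi_apply, LinearMap.smul_apply, h, Pi.smul_apply, smul_eq_mul]
  field_simp

end

/-- A three-dimensional space of pure tensors in `F² ⊗ F³ ⊗ F³` has a fixed first factor, and a fixed
second or third factor. -/
theorem exists_factor_of_isPure (l : Fin 2 → Fin 3 → Fin 3 → (Fin 3 → F) →ₗ[F] F)
    (hl : ∀ u, u ≠ 0 → IsPure fun i j k => l i j k u) :
    (∃ (a : Fin 2 → F) (b : Fin 3 → F) (φ : (Fin 3 → F) →ₗ[F] Fin 3 → F), a ≠ 0 ∧ b ≠ 0 ∧ Function.Injective φ ∧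
      ∀ u i j k, l i j k u = a i * b j * φ u k) ∨
    (∃ (a : Fin 2 → F) (c : Fin 3 → F) (φ : (Fin 3 → F) →ₗ[F] Fin 3 → F), a ≠ 0 ∧ c ≠ 0 ∧ Function.Injective φ ∧
      ∀ u i j k, l i j k u = a i * φ u j * c k) := by
  choose! a b c ha hb hc h using hl
  replace h : ∀ u, u ≠ 0 → ∀ i j k, l i j k u = a u i * b u j * c u k := h
  have hadj : ∀ u v, u ≠ 0 → v ≠ 0 → Adjacent (a u) (a v) (b u) (b v) (c u) (c v) := by
    intro u v hu hv
    refine adjacent_of_add (ha u hu) (ha v hv) (hb u hu) (hb v hv) (hc u hu) (hc v hv) ?_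
    by_cases huv : u + v = 0
    · refine ⟨0, 0, 0, fun i j k => ?_⟩
      rw [← h u hu, ← h v hv, ← map_add, huv]
      simp
    · refine ⟨a (u + v), b (u + v), c (u + v), fun i j k => ?_⟩
      rw [← h u hu, ← h v hv, ← map_add]
      exact h _ huv i j k
  have hl0 : ∀ u, (∀ i j k, l i j k u = 0) → u = 0 := by
    intro u hu
    by_contra hu0
    obtain ⟨i, hi⟩ := Function.ne_iff.1 (ha u hu0)
    obtain ⟨j, hj⟩ := Function.ne_iff.1 (hb u hu0)
    obtain ⟨k, hk⟩ := Function.ne_iff.1 (hc u hu0)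
    have := h u hu0 i j k
    rw [hu] at this
    exact mul_ne_zero (mul_ne_zero hi hj) hk this.symm
  have third : ∀ u, u ≠ 0 → (∀ w, w ≠ 0 → Par (a u) (a w) ∧ Par (b u) (b w)) →
      ∃ (a : Fin 2 → F) (b : Fin 3 → F) (φ : (Fin 3 → F) →ₗ[F] Fin 3 → F), a ≠ 0 ∧ b ≠ 0 ∧ Function.Injective φ ∧
        ∀ u i j k, l i j k u = a i * b j * φ u k := by
    intro u hu hw
    obtain ⟨φ, hφ⟩ := exists_linear_factor l (ha u hu) (hb u hu)
      fun w hw0 => ⟨_, _, _, (hw w hw0).1, (hw w hw0).2, h w hw0⟩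
    refine ⟨a u, b u, φ, ha u hu, hb u hu, (injective_iff_map_eq_zero φ).2 fun w hw0 => ?_, hφ⟩
    exact hl0 w fun i j k => by simp [hφ, hw0]
  by_cases h3 : ∃ u v, u ≠ 0 ∧ v ≠ 0 ∧ ¬ Par (c u) (c v)
  · obtain ⟨u, v, hu, hv, huv⟩ := h3
    exact Or.inl (third u hu (par_of_adjacent ha hb hc hadj hu hv huv))
  push Not at h3
  by_cases h2 : ∃ u v, u ≠ 0 ∧ v ≠ 0 ∧ ¬ Par (b u) (b v)
  · obtain ⟨u, v, hu, hv, huv⟩ := h2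
    have hpar := par_of_adjacent ha hc hb
      (fun u v hu hv => by have := hadj u v hu hv; unfold Adjacent at *; tauto) hu hv huv
    obtain ⟨φ, hφ⟩ := exists_linear_factor (fun i k j => l i j k) (ha u hu) (hc u hu)
      fun w hw0 => ⟨a w, c w, b w, (hpar w hw0).1, (hpar w hw0).2, fun i k j => by
        rw [h w hw0]; ring⟩
    refine Or.inr ⟨a u, c u, φ, ha u hu, hc u hu, (injective_iff_map_eq_zero φ).2 fun w hw0 => ?_,
      fun w i j k => by rw [hφ]; ring⟩
    exact hl0 w fun i j k => by simp [hφ w i k j, hw0]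
  push Not at h2
  have he : (Pi.single 0 1 : Fin 3 → F) ≠ 0 := by simp
  -- otherwise only the first factor varies, but it lives in a space of dimension two
  obtain ⟨φ, hφ⟩ := exists_linear_factor (fun j k i => l i j k) (hb _ he) (hc _ he)
    fun w hw0 => ⟨b w, c w, a w, h2 _ _ he hw0, h3 _ _ he hw0, fun j k i => by rw [h w hw0]; ring⟩
  have hφinj : Function.Injective φ := (injective_iff_map_eq_zero φ).2 fun w hw0 =>
    hl0 w fun i j k => by simp [hφ w j k i, hw0]
  have := LinearMap.finrank_le_finrank_of_injective hφinj
  simp at this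

theorem exists_not_par {p : Fin 3 → F} {φ : (Fin 3 → F) →ₗ[F] Fin 3 → F} (hp : p ≠ 0)
    (hφ : Function.Injective φ) : ∃ u, ¬ Par p (φ u) := by
  by_contra! hcon
  obtain ⟨r, hr⟩ := (hcon (Pi.single 0 1)).exists_eq_smul hp
  obtain ⟨s, hs⟩ := (hcon (Pi.single 1 1)).exists_eq_smul hp
  have h0 : φ (s • Pi.single 0 1 - r • Pi.single 1 1) = 0 := by
    rw [map_sub, map_smul, map_smul, hr, hs, smul_smul, smul_smul, mul_comm, sub_self]
  have h1 := hφ (h0.trans (map_zero φ).symm)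
  have hs0 := congrFun h1 0
  have hr0 := congrFun h1 1
  simp only [Pi.sub_apply, Pi.smul_apply, Pi.single_apply] at hs0 hr0
  simp at hs0 hr0
  rw [hr0, zero_smul] at hr
  have h2 := congrFun (hφ (hr.trans (map_zero φ).symm)) 0
  simp at h2

/-- A space is not the union of two proper subspaces. -/
theorem exists_not_par_not_par {p q : Fin 3 → F} {φ ψ : (Fin 3 → F) →ₗ[F] Fin 3 → F} (hp : p ≠ 0)
    (hq : q ≠ 0) (hφ : Function.Injective φ) (hψ : Function.Injective ψ) :
    ∃ u, ¬ Par p (φ u) ∧ ¬ Par q (ψ u) := by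
  obtain ⟨u, hu⟩ := exists_not_par hp hφ
  obtain ⟨v, hv⟩ := exists_not_par hq hψ
  by_cases hu' : Par q (ψ u)
  · by_cases hv' : Par p (φ v)
    · refine ⟨v + u, fun h => hu ?_, fun h => hv ?_⟩
      · exact (map_add φ v u ▸ h).of_add hv'
      · rw [add_comm, map_add] at h
        exact h.of_add hu'
    · exact ⟨v, hv', hv⟩
  · exact ⟨u, hu, hu'⟩

/-- Linear maps that agree up to scalars on each vector agree up to one scalar. -/
theorem exists_eq_smul_of_par {φ ψ : (Fin 3 → F) →ₗ[F] Fin 3 → F} (hφ : Function.Injective φ)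
    (h : ∀ u, Par (φ u) (ψ u)) : ∃ r : F, ψ = r • φ := by
  let e := LinearEquiv.ofInjectiveEndo φ hφ
  have he : ∀ u, e u = φ u := fun u => rfl
  obtain ⟨r, hr⟩ := LinearMap.exists_eq_smul_id_of_forall_notLinearIndependent
    (f := e.symm.toLinearMap ∘ₗ ψ) fun v => by
      by_cases hv : v = 0
      · intro hli
        exact hli.ne_zero 0 (by simp [hv])
      · obtain ⟨s, hs⟩ := (h v).exists_eq_smul (fun h0 => hv (hφ (h0.trans (map_zero φ).symm)))
        intro hli
        have := LinearIndependent.pair_iff.1 hli s (-1) (by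
          simp [hs, ← he])
        simp at this
  refine ⟨r, LinearMap.ext fun u => ?_⟩
  have := LinearMap.congr_fun hr u
  simp only [LinearMap.comp_apply, LinearEquiv.coe_coe, LinearMap.smul_apply, Module.End.one_apply] at this
  rw [LinearEquiv.symm_apply_eq, map_smul, he] at this
  simpa using this

theorem IsPure.exists_ne_zero {ι₁ ι₂ ι₃ : Type*} {f : ι₁ → ι₂ → ι₃ → F} (h : IsPure f) :
    ∃ i j k, f i j k ≠ 0 := by
  obtain ⟨a, b, c, ha, hb, hc, h⟩ := h
  obtain ⟨i, hi⟩ := Function.ne_iff.1 ha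
  obtain ⟨j, hj⟩ := Function.ne_iff.1 hb
  obtain ⟨k, hk⟩ := Function.ne_iff.1 hc
  exact ⟨i, j, k, by rw [h]; exact mul_ne_zero (mul_ne_zero hi hj) hk⟩

/-- A bilinear family of pure tensors splits if one of its linear subfamilies has a fixed second
factor. -/
theorem exists_split_of_exists_factor
    (B : Fin 2 → Fin 3 → Fin 3 → (Fin 3 → F) →ₗ[F] (Fin 3 → F) →ₗ[F] F)
    (hB : ∀ b c, b ≠ 0 → c ≠ 0 → IsPure fun i j k => B i j k b c)
    (hpar : ∀ b c b' c', b ≠ 0 → c ≠ 0 → b' ≠ 0 → c' ≠ 0 →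
      (∀ i j k, B i j k b c = B i j k b' c') → Par b b')
    {b₀ : Fin 3 → F}
    (h₀ : ∃ (a : Fin 2 → F) (p : Fin 3 → F) (φ : (Fin 3 → F) →ₗ[F] Fin 3 → F), a ≠ 0 ∧ p ≠ 0 ∧
      Function.Injective φ ∧ ∀ c i j k, B i j k b₀ c = a i * p j * φ c k) :
    ∃ (a : Fin 2 → F) (ψ φ : (Fin 3 → F) →ₗ[F] Fin 3 → F), a ≠ 0 ∧ Function.Injective ψ ∧
      Function.Injective φ ∧ ∀ b c i j k, B i j k b c = a i * ψ b j * φ c k := by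
  obtain ⟨a₀, p₀, φ, ha₀, hp₀, hφ, h₀⟩ := h₀
  have hφ0 : ∀ c, c ≠ 0 → φ c ≠ 0 := fun c hc h => hc (hφ (h.trans (map_zero φ).symm))
  have hb₀ : b₀ ≠ 0 := by
    rintro rfl
    obtain ⟨i, hi⟩ := Function.ne_iff.1 ha₀
    obtain ⟨j, hj⟩ := Function.ne_iff.1 hp₀
    have hc : (Pi.single 0 1 : Fin 3 → F) ≠ 0 := by simp
    obtain ⟨k, hk⟩ := Function.ne_iff.1 (hφ0 _ hc)
    have := h₀ (Pi.single 0 1) i j k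
    rw [map_zero, LinearMap.zero_apply] at this
    exact mul_ne_zero (mul_ne_zero hi hj) hk this.symm
  -- the third factor does not depend on `b`
  have key : ∀ b, b ≠ 0 → ∃ (a : Fin 2 → F) (p : Fin 3 → F), a ≠ 0 ∧ p ≠ 0 ∧
      ∀ c i j k, B i j k b c = a i * p j * φ c k := by
    intro b hb
    by_cases hb₀b : Par b₀ b
    · obtain ⟨r, rfl⟩ := hb₀b.exists_eq_smul hb₀
      refine ⟨r • a₀, p₀, smul_ne_zero (fun h => hb (by rw [h, zero_smul])) ha₀, hp₀,
        fun c i j k => ?_⟩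
      rw [map_smul, LinearMap.smul_apply, h₀, Pi.smul_apply, smul_eq_mul, smul_eq_mul]
      ring
    have hadd : b₀ + b ≠ 0 := by
      intro h
      rw [eq_neg_of_add_eq_zero_right h] at hb₀b
      refine hb₀b fun i j => ?_
      simp only [Pi.neg_apply]
      ring
    have hadj : ∀ (c : Fin 3 → F) (a : Fin 2 → F) (p q : Fin 3 → F), c ≠ 0 → a ≠ 0 → p ≠ 0 →
        q ≠ 0 → (∀ i j k, B i j k b c = a i * p j * q k) → Adjacent a₀ a p₀ p (φ c) q := by
      intro c a p q hc ha hp hq h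
      obtain ⟨a'', p'', q'', -, -, -, h''⟩ := hB _ c hadd hc
      exact adjacent_of_add ha₀ ha hp₀ hp (hφ0 c hc) hq
        ⟨a'', p'', q'', fun i j k => by rw [← h₀, ← h, ← h'']; simp⟩
    obtain ⟨a, p, φ', ha, hp, hφ', h⟩ | ⟨a, q, ψ, ha, hq, hψ, h⟩ :=
      exists_factor_of_isPure (fun i j k => B i j k b) fun c hc => hB b c hb hc
    · have hφφ' : ∀ c, Par (φ c) (φ' c) := by
        intro c
        by_contra hc
        have hc0 : c ≠ 0 := by
          rintro rfl
          exact hc fun i j => by simp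
        have := hadj c a p (φ' c) hc0 ha hp (fun h => hc0 (hφ' (h.trans (map_zero φ').symm))) (h c)
        simp only [Adjacent, hc, and_false, or_false] at this
        obtain ⟨r, rfl⟩ := this.1.exists_eq_smul ha₀
        obtain ⟨s, rfl⟩ := this.2.exists_eq_smul hp₀
        obtain ⟨c', hc'⟩ := LinearMap.injective_iff_surjective.1 hφ ((r * s) • φ' c)
        have heq : ∀ i j k, B i j k b₀ c' = B i j k b c := by
          intro i j k
          rw [h₀, h, hc']
          simp only [Pi.smul_apply, smul_eq_mul]
          ring
        refine hb₀b (hpar b₀ c' b c hb₀ ?_ hb hc0 heq)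
        rintro rfl
        obtain ⟨i, j, k, hne⟩ := (hB b c hb hc0).exists_ne_zero
        exact hne (by rw [← heq, map_zero])
      obtain ⟨r, rfl⟩ := exists_eq_smul_of_par hφ hφφ'
      refine ⟨r • a, p, smul_ne_zero ?_ ha, hp, fun c i j k => ?_⟩
      · rintro rfl
        have := congrFun (@hφ' (Pi.single 0 1) 0 (by simp)) 0
        simp at this
      · rw [h]
        simp only [LinearMap.smul_apply, Pi.smul_apply, smul_eq_mul]
        ring
    · exfalso
      obtain ⟨c, hc, hc'⟩ := exists_not_par_not_par hp₀ hq hψ hφ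
      have hc0 : c ≠ 0 := by
        rintro rfl
        exact hc fun i j => by simp
      have := hadj c a (ψ c) q hc0 ha (fun h => hc0 (hψ (h.trans (map_zero ψ).symm))) hq (h c)
      have hc'' : ¬ Par (φ c) q := fun h => hc' h.symm
      simp [Adjacent, hc, hc''] at this
  choose! a p ha hp h using key
  have hc₀ : (Pi.single 0 1 : Fin 3 → F) ≠ 0 := by simp
  set c₀ : Fin 3 → F := Pi.single 0 1
  obtain ⟨k₀, hk₀⟩ := Function.ne_iff.1 (hφ0 _ hc₀)
  replace hk₀ : φ c₀ k₀ ≠ 0 := hk₀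
  obtain ⟨a₁, p₁, χ, ha₁, hp₁, hχ, h₁⟩ | ⟨a₁, q₁, ψ, ha₁, hq₁, hψ, h₁⟩ :=
    exists_factor_of_isPure (fun i j k => (B i j k).flip c₀) fun b hb => hB b c₀ hb hc₀
  · exfalso
    obtain ⟨u, hu⟩ := exists_not_par (hφ0 _ hc₀) hχ
    have hu0 : u ≠ 0 := by
      rintro rfl
      exact hu fun i j => by simp
    obtain ⟨i, hi⟩ := Function.ne_iff.1 ha₁
    obtain ⟨j, hj⟩ := Function.ne_iff.1 hp₁
    have e : ∀ k, a u i * p u j * φ c₀ k = a₁ i * p₁ j * χ u k := fun k => by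
      rw [← h u hu0, ← h₁, LinearMap.flip_apply]
    refine hu fun k k' => mul_left_cancel₀ (mul_ne_zero hi hj) ?_
    linear_combination φ c₀ k' * e k - φ c₀ k * e k'
  · have e : ∀ b, b ≠ 0 → ∀ i j, a b i * p b j * φ c₀ k₀ = a₁ i * ψ b j * q₁ k₀ :=
      fun b hb i j => by rw [← h b hb, ← h₁, LinearMap.flip_apply]
    refine ⟨a₁, (q₁ k₀ / φ c₀ k₀) • ψ, φ, ha₁, ?_, hφ, fun b c i j k => ?_⟩
    · have hq₀ : q₁ k₀ ≠ 0 := by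
        intro hq₀
        obtain ⟨i, hi⟩ := Function.ne_iff.1 (ha _ hc₀)
        obtain ⟨j, hj⟩ := Function.ne_iff.1 (hp _ hc₀)
        exact mul_ne_zero (mul_ne_zero hi hj) hk₀ (by rw [e _ hc₀, hq₀, mul_zero])
      intro x y hxy
      exact hψ (smul_right_injective _ (div_ne_zero hq₀ hk₀) hxy)
    · by_cases hb : b = 0
      · simp [hb]
      · rw [h b hb]
        simp only [LinearMap.smul_apply, Pi.smul_apply, smul_eq_mul]
        have := e b hb i j
        field_simp
        linear_combination φ c k * this

/-- A bilinear family of pure tensors, in which equal members have proportional first parameters, has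
a fixed first factor, and its parameters act separately on the other two factors. -/
theorem exists_split_of_isPure
    (B : Fin 2 → Fin 3 → Fin 3 → (Fin 3 → F) →ₗ[F] (Fin 3 → F) →ₗ[F] F)
    (hB : ∀ b c, b ≠ 0 → c ≠ 0 → IsPure fun i j k => B i j k b c)
    (hpar : ∀ b c b' c', b ≠ 0 → c ≠ 0 → b' ≠ 0 → c' ≠ 0 →
      (∀ i j k, B i j k b c = B i j k b' c') → Par b b') :
    (∃ (a : Fin 2 → F) (ψ φ : (Fin 3 → F) →ₗ[F] Fin 3 → F), a ≠ 0 ∧ Function.Injective ψ ∧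
      Function.Injective φ ∧ ∀ b c i j k, B i j k b c = a i * ψ b j * φ c k) ∨
    (∃ (a : Fin 2 → F) (ψ φ : (Fin 3 → F) →ₗ[F] Fin 3 → F), a ≠ 0 ∧ Function.Injective ψ ∧
      Function.Injective φ ∧ ∀ b c i j k, B i j k b c = a i * ψ c j * φ b k) := by
  have hb : (Pi.single 0 1 : Fin 3 → F) ≠ 0 := by simp
  obtain h | ⟨a, q, ψ, ha, hq, hψ, h⟩ :=
    exists_factor_of_isPure (fun i j k => B i j k (Pi.single 0 1)) fun c hc => hB _ c hb hc
  · exact Or.inl (exists_split_of_exists_factor B hB hpar h)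
  · obtain ⟨a, ψ, φ, ha, hψ, hφ, h⟩ := exists_split_of_exists_factor (fun i j k => B i k j)
      (fun b c hb hc => by
        obtain ⟨a, p, q, ha, hp, hq, h⟩ := hB b c hb hc
        exact ⟨a, q, p, ha, hq, hp, fun i j k => by rw [h]; ring⟩)
      (fun b c b' c' hb hc hb' hc' h => hpar b c b' c' hb hc hb' hc' fun i j k => h i k j)
      ⟨a, q, ψ, ha, hq, hψ, fun c i j k => by rw [h]; ring⟩
    exact Or.inr ⟨a, φ, ψ, ha, hφ, hψ, fun b c i j k => by rw [h]; ring⟩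

/-! ### The stabiliser of the set of fundamental tensors -/

/-- The coordinates of a tensor in the standard basis. -/
noncomputable def coord (i : Fin 2) (j k : Fin 3) : Tensor233 F →ₗ[F] F :=
  ((Pi.basisFun F (Fin 2)).tensorProduct
    ((Pi.basisFun F (Fin 3)).tensorProduct (Pi.basisFun F (Fin 3)))).coord (i, j, k)

theorem coord_tmul (i : Fin 2) (j k : Fin 3) (a : Fin 2 → F) (b c : Fin 3 → F) :
    coord i j k (a ⊗ₜ (b ⊗ₜ c)) = a i * b j * c k := by
  simp [coord]
  ring

theorem ext_coord {x y : Tensor233 F} (h : ∀ i j k, coord i j k x = coord i j k y) : x = y :=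
  ((Pi.basisFun F (Fin 2)).tensorProduct
    ((Pi.basisFun F (Fin 3)).tensorProduct (Pi.basisFun F (Fin 3)))).ext_elem
      fun p => h p.1 p.2.1 p.2.2

theorem isPure_coord {x : Tensor233 F} (hx : x ∈ fundamentalTensors F (Fin 2 → F) (Fin 3 → F)
    (Fin 3 → F)) : IsPure fun i j k => coord i j k x := by
  obtain ⟨a, b, c, ha, hb, hc, rfl⟩ := hx
  exact ⟨a, b, c, ha, hb, hc, fun i j k => coord_tmul i j k a b c⟩

theorem par_of_tmul_eq {a a' : Fin 2 → F} {b b' c c' : Fin 3 → F} (ha : a ≠ 0) (hb : b ≠ 0)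
    (hc : c ≠ 0) (h : a' ⊗ₜ[F] (b' ⊗ₜ[F] c') = a ⊗ₜ[F] (b ⊗ₜ[F] c)) : Par a a' ∧ Par b b' := by
  obtain ⟨i₀, hi₀⟩ := Function.ne_iff.1 ha
  obtain ⟨j₀, hj₀⟩ := Function.ne_iff.1 hb
  obtain ⟨k₀, hk₀⟩ := Function.ne_iff.1 hc
  have e : ∀ i j k, a' i * b' j * c' k = a i * b j * c k := fun i j k => by
    rw [← coord_tmul, ← coord_tmul, h]
  constructor
  · intro i j
    refine mul_left_cancel₀ (mul_ne_zero hj₀ hk₀) ?_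
    linear_combination a' i * e j j₀ k₀ - a' j * e i j₀ k₀
  · intro i j
    refine mul_left_cancel₀ (mul_ne_zero hi₀ hk₀) ?_
    linear_combination b' i * e i₀ j k₀ - b' j * e i₀ i k₀

theorem eq_smul_single_add (a : Fin 2 → F) :
    a = a 0 • Pi.single 0 1 + a 1 • Pi.single 1 1 := by
  ext i
  fin_cases i <;> simp

theorem tmul_ne_zero {a : Fin 2 → F} {b c : Fin 3 → F} (ha : a ≠ 0) (hb : b ≠ 0) (hc : c ≠ 0) :
    a ⊗ₜ[F] (b ⊗ₜ[F] c) ≠ 0 := by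
  intro h
  obtain ⟨i, hi⟩ := Function.ne_iff.1 ha
  obtain ⟨j, hj⟩ := Function.ne_iff.1 hb
  obtain ⟨k, hk⟩ := Function.ne_iff.1 hc
  have := coord_tmul i j k a b c
  rw [h, map_zero] at this
  exact mul_ne_zero (mul_ne_zero hi hj) hk this.symm

/-- A linear automorphism preserving purity acts on the tensors with given first factor through maps
of the other two factors, up to interchanging these. -/
theorem exists_split (g : Tensor233 F ≃ₗ[F] Tensor233 F)
    (hg : ∀ a b c, a ≠ 0 → b ≠ 0 → c ≠ 0 → IsPure fun i j k => coord i j k (g (a ⊗ₜ (b ⊗ₜ c))))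
    (a : Fin 2 → F) (ha : a ≠ 0) :
    (∃ (a' : Fin 2 → F) (ψ φ : (Fin 3 → F) →ₗ[F] Fin 3 → F), a' ≠ 0 ∧ Function.Injective ψ ∧
      Function.Injective φ ∧
        ∀ b c i j k, coord i j k (g (a ⊗ₜ (b ⊗ₜ c))) = a' i * ψ b j * φ c k) ∨
    (∃ (a' : Fin 2 → F) (ψ φ : (Fin 3 → F) →ₗ[F] Fin 3 → F), a' ≠ 0 ∧ Function.Injective ψ ∧
      Function.Injective φ ∧
        ∀ b c i j k, coord i j k (g (a ⊗ₜ (b ⊗ₜ c))) = a' i * ψ c j * φ b k) := by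
  refine exists_split_of_isPure (fun i j k => (TensorProduct.mk F (Fin 3 → F) (Fin 3 → F)).compr₂
    (coord i j k ∘ₗ g.toLinearMap ∘ₗ TensorProduct.mk F (Fin 2 → F) _ a))
    (fun b c hb hc => hg a b c ha hb hc) fun b c b' c' hb hc hb' hc' h => ?_
  have := g.injective (ext_coord h)
  exact (par_of_tmul_eq ha hb hc this.symm).2

/-- If the automorphism splits without interchange on the tensors with first factor `e₀`, then it does
so on those with first factor `e₁`, with proportional maps; hence it splits altogether. -/
theorem mem_groupH_of_split (g : Tensor233 F ≃ₗ[F] Tensor233 F)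
    (hg : ∀ a b c, a ≠ 0 → b ≠ 0 → c ≠ 0 → IsPure fun i j k => coord i j k (g (a ⊗ₜ (b ⊗ₜ c))))
    (h : ∃ (a' : Fin 2 → F) (ψ φ : (Fin 3 → F) →ₗ[F] Fin 3 → F), a' ≠ 0 ∧ Function.Injective ψ ∧
      Function.Injective φ ∧
        ∀ b c i j k, coord i j k (g (Pi.single 0 1 ⊗ₜ (b ⊗ₜ c))) = a' i * ψ b j * φ c k) :
    g ∈ groupH F (Fin 2 → F) (Fin 3 → F) (Fin 3 → F) := by
  obtain ⟨a₁, ψ₁, φ₁, ha₁, hψ₁, hφ₁, h₁⟩ := h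
  have hne : ∀ {φ : (Fin 3 → F) →ₗ[F] Fin 3 → F}, Function.Injective φ → ∀ b, b ≠ 0 → φ b ≠ 0 :=
    fun {φ} hφ b hb h => hb (hφ (h.trans (map_zero φ).symm))
  have he : (Pi.single 1 1 : Fin 2 → F) ≠ 0 := by simp
  have hee : (Pi.single 0 1 + Pi.single 1 1 : Fin 2 → F) ≠ 0 := fun h => by
    simpa using congrFun h 0
  have hb₀ : (Pi.single 0 1 : Fin 3 → F) ≠ 0 := by simp
  have hsum : ∀ b c : Fin 3 → F, b ≠ 0 → c ≠ 0 → ∃ (a'' : Fin 2 → F) (b'' c'' : Fin 3 → F),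
      ∀ i j k, coord i j k (g (Pi.single 0 1 ⊗ₜ (b ⊗ₜ c))) +
        coord i j k (g (Pi.single 1 1 ⊗ₜ (b ⊗ₜ c))) = a'' i * b'' j * c'' k := by
    intro b c hb hc
    obtain ⟨a'', b'', c'', -, -, -, h''⟩ := hg _ b c hee hb hc
    replace h'' : ∀ i j k, coord i j k (g ((Pi.single 0 1 + Pi.single 1 1) ⊗ₜ (b ⊗ₜ c))) =
      a'' i * b'' j * c'' k := h''
    simp only [TensorProduct.add_tmul, map_add] at h''
    exact ⟨a'', b'', c'', h''⟩
  obtain ⟨a₂, ψ₂, φ₂, ha₂, hψ₂, hφ₂, h₂⟩ | ⟨a₂, ψ₂, φ₂, ha₂, hψ₂, hφ₂, h₂⟩ :=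
    exists_split g hg (Pi.single 1 1) he
  · -- otherwise `e₀ ⊗ F³ ⊗ F³` and `e₁ ⊗ F³ ⊗ F³` have the same image
    have ha : ¬ Par a₁ a₂ := by
      intro ha
      obtain ⟨r, rfl⟩ := ha.exists_eq_smul ha₁
      obtain ⟨b, hb⟩ := LinearMap.injective_iff_surjective.1 hψ₁ (ψ₂ (Pi.single 0 1))
      obtain ⟨c, hc⟩ := LinearMap.injective_iff_surjective.1 hφ₁ (r • φ₂ (Pi.single 0 1))
      have : g (Pi.single 0 1 ⊗ₜ (b ⊗ₜ c)) = g (Pi.single 1 1 ⊗ₜ (Pi.single 0 1 ⊗ₜ Pi.single 0 1)) :=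
        ext_coord fun i j k => by
          rw [h₁, h₂, hb, hc]
          simp only [Pi.smul_apply, smul_eq_mul]
          ring
      have := (par_of_tmul_eq he hb₀ hb₀ (g.injective this)).1 0 1
      simp at this
    have hpar : ∀ b c, b ≠ 0 → c ≠ 0 → Par (ψ₁ b) (ψ₂ b) ∧ Par (φ₁ c) (φ₂ c) := by
      intro b c hb hc
      obtain ⟨a'', b'', c'', h''⟩ := hsum b c hb hc
      simp only [h₁, h₂] at h''
      exact par_of_add_eq (hne hψ₁ b hb) (hne hψ₂ b hb) (hne hφ₁ c hc) (hne hφ₂ c hc) h'' ha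
    obtain ⟨μ, rfl⟩ := exists_eq_smul_of_par hψ₁ fun b => by
      by_cases hb : b = 0
      · subst hb
        exact fun i j => by simp
      · exact (hpar b _ hb hb₀).1
    obtain ⟨ν, rfl⟩ := exists_eq_smul_of_par hφ₁ fun c => by
      by_cases hc : c = 0
      · subst hc
        exact fun i j => by simp
      · exact (hpar _ c hb₀ hc).2
    let θ : (Fin 2 → F) →ₗ[F] Fin 2 → F :=
      (LinearMap.proj 0).smulRight a₁ + (LinearMap.proj 1).smulRight ((μ * ν) • a₂)
    have hθ : ∀ a b c i j k, coord i j k (g (a ⊗ₜ (b ⊗ₜ c))) = θ a i * ψ₁ b j * φ₁ c k := by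
      intro a b c i j k
      conv_lhs => rw [eq_smul_single_add a]
      rw [TensorProduct.add_tmul, map_add, map_add, ← TensorProduct.smul_tmul',
        ← TensorProduct.smul_tmul', map_smul, map_smul, map_smul, map_smul, h₁, h₂]
      simp [θ]
      ring
    have hθinj : Function.Injective θ := (injective_iff_map_eq_zero θ).2 fun a ha0 => by
      by_contra hane
      refine tmul_ne_zero hane hb₀ hb₀ (g.injective ((ext_coord fun i j k => ?_).trans
        g.map_zero.symm))
      rw [hθ, ha0]
      simp
    refine ⟨(LinearEquiv.ofInjectiveEndo θ hθinj, LinearEquiv.ofInjectiveEndo ψ₁ hψ₁,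
      LinearEquiv.ofInjectiveEndo φ₁ hφ₁), LinearEquiv.toLinearMap_injective
        (tensor_hom_ext fun a b c => ext_coord fun i j k => ?_)⟩
    exact (coord_tmul i j k _ _ _).trans (hθ a b c i j k).symm
  · -- with an interchange at `e₁` only, some image of `(e₀ + e₁) ⊗ b ⊗ c` is not fundamental
    exfalso
    obtain ⟨c, hc, hc'⟩ := exists_not_par_not_par (hne hψ₁ _ hb₀) (hne hφ₂ _ hb₀) hψ₂ hφ₁
    have hc0 : c ≠ 0 := by
      rintro rfl
      exact hc fun i j => by simp
    obtain ⟨a'', b'', c'', h''⟩ := hsum _ c hb₀ hc0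
    have := adjacent_of_add ha₁ ha₂ (hne hψ₁ _ hb₀) (hne hψ₂ c hc0) (hne hφ₁ c hc0) (hne hφ₂ _ hb₀)
      ⟨a'', b'', c'', fun i j k => by rw [← h₁, ← h₂, h'']⟩
    have hc'' : ¬ Par (φ₁ c) (φ₂ (Pi.single 0 1)) := fun h => hc' h.symm
    simp [Adjacent, hc, hc''] at this

theorem swapTensor_tmul (a : Fin 2 → F) (b c : Fin 3 → F) :
    swapTensor (a ⊗ₜ (b ⊗ₜ c)) = a ⊗ₜ[F] (c ⊗ₜ[F] b) := rfl

theorem coord_swapTensor (i : Fin 2) (j k : Fin 3) (x : Tensor233 F) :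
    coord i j k (swapTensor x) = coord i k j x := by
  have : coord i j k ∘ₗ swapTensor.toLinearMap = coord (F := F) i k j :=
    tensor_hom_ext fun a b c => by
      rw [LinearMap.comp_apply, LinearEquiv.coe_coe, swapTensor_tmul, coord_tmul, coord_tmul]
      ring
  exact LinearMap.congr_fun this x

theorem mem_groupG_iff {g : Tensor233 F ≃ₗ[F] Tensor233 F} :
    g ∈ groupG F (Fin 2 → F) (Fin 3 → F) (Fin 3 → F) ↔
      ∀ x, g x ∈ fundamentalTensors F (Fin 2 → F) (Fin 3 → F) (Fin 3 → F) ↔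
        x ∈ fundamentalTensors F (Fin 2 → F) (Fin 3 → F) (Fin 3 → F) :=
  MulAction.mem_stabilizer_set

theorem groupH_le_groupG : groupH F (Fin 2 → F) (Fin 3 → F) (Fin 3 → F) ≤ groupG F _ _ _ := by
  have key : ∀ t x, x ∈ fundamentalTensors F (Fin 2 → F) (Fin 3 → F) (Fin 3 → F) →
      tensorAction F _ _ _ t x ∈ fundamentalTensors F (Fin 2 → F) (Fin 3 → F) (Fin 3 → F) := by
    rintro ⟨g₁, g₂, g₃⟩ _ ⟨a, b, c, ha, hb, hc, rfl⟩
    exact ⟨g₁ a, g₂ b, g₃ c, by simpa using ha, by simpa using hb, by simpa using hc, rfl⟩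
  rintro _ ⟨t, rfl⟩
  refine mem_groupG_iff.2 fun x => ⟨fun hx => ?_, key t x⟩
  have := key t⁻¹ _ hx
  rwa [← LinearEquiv.mul_apply, ← map_mul, inv_mul_cancel, map_one, LinearEquiv.coe_one] at this

theorem swapTensor_mem_groupG :
    swapTensor ∈ groupG F (Fin 2 → F) (Fin 3 → F) (Fin 3 → F) := by
  have key : ∀ x, x ∈ fundamentalTensors F (Fin 2 → F) (Fin 3 → F) (Fin 3 → F) →
      swapTensor x ∈ fundamentalTensors F (Fin 2 → F) (Fin 3 → F) (Fin 3 → F) := by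
    rintro _ ⟨a, b, c, ha, hb, hc, rfl⟩
    exact ⟨a, c, b, ha, hc, hb, rfl⟩
  refine mem_groupG_iff.2 fun x => ⟨fun hx => ?_, key x⟩
  have := key _ hx
  rwa [show swapTensor (swapTensor x) = x from ext_coord fun i j k => by
    rw [coord_swapTensor, coord_swapTensor]] at this

/-- The stabiliser of the set of fundamental tensors is generated by `groupH` and the interchange of
the last two factors. -/
theorem mem_groupH_or_swapTensor_mul_mem_groupH {g : Tensor233 F ≃ₗ[F] Tensor233 F}
    (hg : g ∈ groupG F (Fin 2 → F) (Fin 3 → F) (Fin 3 → F)) :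
    g ∈ groupH F (Fin 2 → F) (Fin 3 → F) (Fin 3 → F) ∨
      swapTensor * g ∈ groupH F (Fin 2 → F) (Fin 3 → F) (Fin 3 → F) := by
  have hpure : ∀ {f}, f ∈ groupG F (Fin 2 → F) (Fin 3 → F) (Fin 3 → F) → ∀ a b c, a ≠ 0 → b ≠ 0 →
      c ≠ 0 → IsPure fun i j k => coord i j k (f (a ⊗ₜ (b ⊗ₜ c))) := fun hf a b c ha hb hc =>
    isPure_coord ((mem_groupG_iff.1 hf _).2 ⟨a, b, c, ha, hb, hc, rfl⟩)
  obtain h | ⟨a, ψ, φ, ha, hψ, hφ, h⟩ := exists_split g (hpure hg) (Pi.single 0 1) (by simp)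
  · exact Or.inl (mem_groupH_of_split g (hpure hg) h)
  · refine Or.inr (mem_groupH_of_split _ (hpure (mul_mem swapTensor_mem_groupG hg))
      ⟨a, φ, ψ, ha, hφ, hψ, fun b c i j k => ?_⟩)
    rw [LinearEquiv.mul_apply, coord_swapTensor, h]
    ring

/-- The `G`-orbits of tensors are the classes of pencils up to equivalence and transposition. -/
theorem mem_orbit_groupG_iff {x y : Tensor233 F} :
    y ∈ MulAction.orbit (groupG F (Fin 2 → F) (Fin 3 → F) (Fin 3 → F)) x ↔
      PencilEquiv (toPencil F x) (toPencil F y) ∨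
        PencilEquiv (toPencil F x) ((toPencil F y).1ᵀ, (toPencil F y).2ᵀ) := by
  rw [← toPencil_swapTensor, ← mem_orbit_groupH_iff, ← mem_orbit_groupH_iff]
  constructor
  · rintro ⟨⟨g, hg⟩, rfl⟩
    exact (mem_groupH_or_swapTensor_mul_mem_groupH hg).imp (fun h => ⟨⟨g, h⟩, rfl⟩)
      fun h => ⟨⟨_, h⟩, rfl⟩
  · rintro (⟨⟨g, hg⟩, rfl⟩ | ⟨⟨g, hg⟩, h⟩)
    · exact ⟨⟨g, groupH_le_groupG hg⟩, rfl⟩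
    · refine ⟨⟨swapTensor * g, mul_mem swapTensor_mem_groupG (groupH_le_groupG hg)⟩, ?_⟩
      refine swapTensor.injective (ext_coord fun i j k => ?_)
      have h' : g x = swapTensor y := h
      change coord i j k (swapTensor (swapTensor (g x))) = _
      rw [coord_swapTensor, coord_swapTensor, h']

end

/-! ### Counting the orbits -/

section

variable {F : Type*} [Field F]

theorem card_HOrbits233 {S : Finset NormalForm} {δ γ : F} (hS : NormalizesRootless S δ γ)
    (hadm : ∀ i ∈ S, i.Admissible δ γ) : Nat.card (HOrbits233 F) = S.card := by
  let f : S → HOrbits233 F := fun i => Quotient.mk _ ((toPencil F).symm (i.1.pencil δ γ))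
  have hf : Function.Bijective f := by
    constructor
    · intro i j hij
      have : _ ∈ MulAction.orbit _ _ := Quotient.exact hij
      rw [mem_orbit_groupH_iff, LinearEquiv.apply_symm_apply,
        LinearEquiv.apply_symm_apply] at this
      exact Subtype.ext
        (NormalForm.eq_of_pencilEquiv (hadm _ j.2) (hadm _ i.2) this).symm
    · intro q
      induction q using Quotient.inductionOn with | h x => ?_
      obtain ⟨i, hi, h⟩ := hS.exists_normalForm (toPencil F x)
      refine ⟨⟨i, hi⟩, Quotient.sound ?_⟩
      change _ ∈ MulAction.orbit _ _
      rwa [mem_orbit_groupH_iff, LinearEquiv.apply_symm_apply]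
  rw [← Nat.card_congr (Equiv.ofBijective f hf), Nat.card_eq_fintype_card, Fintype.card_coe]

/-- Representatives of the normal forms up to transposition. -/
def NormalForm.transposeReps : Finset NormalForm :=
  {i | i ≠ .L₁J₁T ∧ i ≠ .L₂T ∧ i ≠ .L₁T}

theorem NormalForm.eq_of_eq_transpose {i j : NormalForm} (hi : i ∈ transposeReps)
    (hj : j ∈ transposeReps) (h : i = j.transpose) : i = j := by
  revert i j
  decide

theorem NormalForm.mem_or_transpose_mem_transposeReps (i : NormalForm) :
    i ∈ transposeReps ∨ i.transpose ∈ transposeReps := by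
  revert i
  decide

theorem NormalForm.transpose_transpose (i : NormalForm) : i.transpose.transpose = i := by
  cases i <;> rfl

theorem card_GOrbits233 {S : Finset NormalForm} {δ γ : F} (hS : NormalizesRootless S δ γ)
    (hadm : ∀ i, i ∈ S → i.Admissible δ γ) :
    Nat.card (GOrbits233 F) = (S ∩ NormalForm.transposeReps).card := by
  let f : ↥(S ∩ NormalForm.transposeReps) → GOrbits233 F := fun i =>
    Quotient.mk _ ((toPencil F).symm (i.1.pencil δ γ))
  have hf : Function.Bijective f := by
    constructor
    · intro i j hij
      have hi := Finset.mem_inter.1 i.2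
      have hj := Finset.mem_inter.1 j.2
      have : _ ∈ MulAction.orbit _ _ := Quotient.exact hij
      rw [mem_orbit_groupG_iff, LinearEquiv.apply_symm_apply,
        LinearEquiv.apply_symm_apply, ← NormalForm.pencil_transpose] at this
      refine Subtype.ext (this.elim (fun h =>
        (NormalForm.eq_of_pencilEquiv (hadm _ hj.1) (hadm _ hi.1) h).symm) fun h => ?_)
      exact (NormalForm.eq_of_eq_transpose hj.2 hi.2
        (NormalForm.eq_of_pencilEquiv (hadm _ hj.1) (hadm _ (hS.transpose_mem hi.1)) h)).symm
    · intro q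
      induction q using Quotient.inductionOn with | h x => ?_
      obtain ⟨i, hi, h⟩ := hS.exists_normalForm (toPencil F x)
      have key : ∀ j, j ∈ S ∩ NormalForm.transposeReps → j = i ∨ j = i.transpose →
          ∃ y, f y = Quotient.mk _ x := by
        intro j hj hji
        refine ⟨⟨j, hj⟩, Quotient.sound ?_⟩
        change _ ∈ MulAction.orbit _ _
        rw [mem_orbit_groupG_iff, LinearEquiv.apply_symm_apply]
        obtain rfl | rfl := hji
        · exact Or.inl h
        · refine Or.inr ?_
          rwa [← NormalForm.pencil_transpose, NormalForm.transpose_transpose]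
      obtain hi' | hi' := i.mem_or_transpose_mem_transposeReps
      · exact key i (Finset.mem_inter.2 ⟨hi, hi'⟩) (Or.inl rfl)
      · exact key _ (Finset.mem_inter.2 ⟨hS.transpose_mem hi, hi'⟩) (Or.inr rfl)
  rw [← Nat.card_congr (Equiv.ofBijective f hf), Nat.card_eq_fintype_card, Fintype.card_coe]

end
end TensorOrbits

theorem mainTheorem1 :
    (∀ (F : Type*) [Field F] [Finite F],
      Nat.card (TensorOrbits.HOrbits233 F) = 21 ∧ Nat.card (TensorOrbits.GOrbits233 F) = 18) ∧
    (∀ (F : Type*) [Field F] [IsAlgClosed F],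
      Nat.card (TensorOrbits.HOrbits233 F) = 18 ∧ Nat.card (TensorOrbits.GOrbits233 F) = 15) ∧
    (Nat.card (TensorOrbits.HOrbits233 ℝ) = 20 ∧ Nat.card (TensorOrbits.GOrbits233 ℝ) = 17) := by
  open TensorOrbits in
  refine ⟨fun F _ _ => ?_, fun F _ _ => ?_, ?_⟩
  · obtain ⟨⟨δ, hδ⟩, γ, hγ⟩ := exists_rootless_of_finite (F := F)
    have hS := normalizesRootless_of_finite hδ hγ
    have hadm : ∀ i ∈ (Finset.univ : Finset NormalForm), i.Admissible δ γ := fun i _ => by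
      cases i <;> first | exact hδ | exact hγ | trivial
    exact ⟨(card_HOrbits233 hS hadm).trans (by decide),
      (card_GOrbits233 hS hadm).trans (by decide)⟩
  · have hS := normalizesRootless_of_isAlgClosed (0 : F) 0
    have hadm : ∀ i ∈ ({i | i ≠ .squareQuadratic ∧ i ≠ .regularQuadratic ∧ i ≠ .regularCubic} :
        Finset NormalForm), i.Admissible (0 : F) 0 := fun i hi => by
      -- for the excluded types `hi` is decidably false
      cases i <;> trivial
    exact ⟨(card_HOrbits233 hS hadm).trans (by decide),
      (card_GOrbits233 hS hadm).trans (by decide)⟩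
  · have hS := normalizesRootless_real 0
    have hδ : ∀ x : ℝ, x ^ 2 - x + 1 ≠ 0 := fun x => by nlinarith [sq_nonneg (2 * x - 1)]
    have hadm : ∀ i ∈ ({i | i ≠ .regularCubic} : Finset NormalForm), i.Admissible (1 : ℝ) 0 :=
      fun i hi => by
        cases i <;> first | exact hδ | trivial
    exact ⟨(card_HOrbits233 hS hadm).trans (by decide),
      (card_GOrbits233 hS hadm).trans (by decide)⟩
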